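/- Notation. $(a,b,\dots)$ denotes the greatest common divisor. For an integer $n\ge 1$ let $F$ be the free group with basis $x_0,\dots,x_{n-1}$ (subscripts modulo $n$) and let $\theta$ be the automorphism of $F$ with $\theta(x_i)=x_{i+1}$. For $w\in F$ put $G_n(w)=\langle x_0,\dots,x_{n-1}\mid w,\theta(w),\dots,\theta^{n-1}(w)\rangle$. For integers $f$ and $r\ge 0$ let $\Lambda(r,f)=x_0x_fx_{2f}\cdots x_{(r-1)f}$, and for $r<0$ let $\Lambda(r,f)=\theta^{rf}(\Lambda(|r|,f))^{-1}$. For integers $M,N\geq 1$, $R$, $\lambda$ let \[B(M,N,R,\lambda)=\left\langle a,b \,\middle|\, a^M=1,\ bab^{-1}=a^R,\ b^N=a^{\lambda M/(M,R-1)}\right\rangle .\] Theorem C. Let $n\ge 1$ and $r,s,f,A$ be integers with $f(r-s)\equiv 0 \bmod n$, and let $G=G_n(w)$ be the cyclically presented group of the class $\mathfrak{M}$ with parameters $(r,n,s,f,A)$, that is, \[w=\begin{cases}\Lambda(r,f)\,\theta^{A}(\Lambda(s,f))^{-1} & \text{if } s\ge 0,\\ \Lambda(r,f)\,\theta^{A+fr}(\Lambda(|s|,f))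 & \text{if } s<0.\end{cases}\] Suppose that $(r,s)=1$ and that $\mu=|r^{n/(n,A)}-s^{n/(n,A)}|\neq 0$. Let $\hat r$ and $\bar\alpha$ be any integers with $r\hat r\equiv 1 \bmod \mu$ and $\alpha\bar\alpha\equiv 1 \bmod n/(n,A)$, where $\alpha=A/(n,A)$. Put \[M=\frac{(n,f)\mu}{n},\qquad N=\frac{n(n,A,f)}{(n,A)(n,f)},\qquad R=(s\hat r)^{f\bar\alpha/(n,A,f)},\qquad \bar G=B(M,N,R,1),\] where, if the exponent of $s\hat r$ is negative, the power is formed with an inverse of $s\hat r$ modulo $M$. Then $M$ and $N$ are integers, $R^N\equiv 1 \bmod M$, and $\bar G$ is a finite metacyclic group (it has a cyclic normal subgroup with cyclic quotient). Moreover $G$ is the free product of $(n,A,f)$ copies of $\bar G$ and the free group $F_k$ of rank $k=(n,A)-(n,A,f)$: \[G\cong\left(\ast_{i=1}^{(n,A,f)}\bar G\right)\ast F_k .\] In particular, if $(n,A)(n,f)=n(n,A,f)$, then \[G\cong\left(\ast_{i=1}^{(n,A,f)}\mathbb{Z}_{(n,f)\mu/n}\right)\ast F_k .\] -/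

import Mathlib

/-- The shift automorphism `x_i ↦ x_{i+1}` of the free group on `x_i`, `i` an integer modulo `n`. -/
def shift (n : ℕ) : MulAut (FreeGroup (ZMod n)) :=
  FreeGroup.freeGroupCongr (Equiv.addRight (1 : ZMod n))

/-- The cyclically presented group `G_n(w) = ⟨x_0, …, x_{n-1} | w, θ(w), …, θ^{n-1}(w)⟩`. -/
abbrev CyclicallyPresentedGroup (n : ℕ) (w : FreeGroup (ZMod n)) : Type :=
  PresentedGroup {u : FreeGroup (ZMod n) | ∃ k : ℕ, k < n ∧ u = (shift n ^ k) w}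

/-- The positive block `Λ(l, f) = x_0 x_f x_{2f} ⋯ x_{(l-1)f}` of length `l` and step size `f`. -/
def block (n : ℕ) (f : ℤ) (l : ℕ) : FreeGroup (ZMod n) :=
  ((List.range l).map fun i => FreeGroup.of (((i : ℤ) * f : ℤ) : ZMod n)).prod

/-- `Λ(r, f)` for an integer `r`. In the shift extension, where `x_i = t^i x_0 t^{-i}` and
`y = x_0 t^f`, one has `y^r = Λ(r, f) t^{rf}`; for negative `r` this forces
`Λ(r, f) = θ^{rf}(Λ(|r|, f))⁻¹ = (x_{-f})⁻¹ (x_{-2f})⁻¹ ⋯ (x_{rf})⁻¹`. -/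
def intBlock (n : ℕ) (f r : ℤ) : FreeGroup (ZMod n) :=
  if 0 ≤ r then block n f r.natAbs
  else ((shift n ^ (r * f)) (block n f r.natAbs))⁻¹

/-- The defining word of the group of type `𝔐` with parameters `(r, n, s, f, A)`:
`Λ(r,f) θ^A(Λ(s,f))⁻¹` if `s ≥ 0`, and `Λ(r,f) θ^{A+fr}(Λ(|s|,f))` if `s < 0`. -/
def wordM (r : ℤ) (n : ℕ) (s f A : ℤ) : FreeGroup (ZMod n) :=
  if 0 ≤ s then intBlock n f r * ((shift n ^ A) (block n f s.natAbs))⁻¹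
  else intBlock n f r * (shift n ^ (A + f * r)) (block n f s.natAbs)

/-- The cyclically presented group of type `𝔐` determined by `(r, n, s, f, A)`
(where `f (r - s) ≡ 0` modulo `n`). -/
abbrev GroupM (r : ℤ) (n : ℕ) (s f A : ℤ) : Type :=
  CyclicallyPresentedGroup n (wordM r n s f A)

/-- Relators of `B(M, N, R, l)`, with `a` the generator `0` and `b` the generator `1`. -/
def beylRels (M N : ℕ) (R l : ℤ) : Set (FreeGroup (Fin 2)) :=
  let a : FreeGroup (Fin 2) := FreeGroup.of 0
  let b : FreeGroup (Fin 2) := FreeGroup.of 1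
  {a ^ M,
   b * a * b⁻¹ * (a ^ R)⁻¹,
   b ^ N * (a ^ (l * ((M / Int.gcd M (R - 1) : ℕ) : ℤ)))⁻¹}

/-- `B(M, N, R, l) = ⟨a, b | a^M = 1, b a b⁻¹ = a^R, b^N = a^{l M / (M, R - 1)}⟩`. -/
abbrev BeylGroup (M N : ℕ) (R l : ℤ) : Type :=
  PresentedGroup (beylRels M N R l)

/-- A group is metacyclic if it has a cyclic normal subgroup with cyclic quotient. -/
def IsMetacyclic (G : Type*) [Group G] : Prop :=
  ∃ (K : Subgroup G) (_ : K.Normal), IsCyclic K ∧ IsCyclic (G ⧸ K)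

/-- The power `b ^ e` of an integer `b` coprime to `M`, as an integer that matters modulo `M`:
the usual power for `e ≥ 0`, and a power of an inverse of `b` modulo `M` for `e < 0`
(the Bézout coefficient `Int.gcdA b M` is such an inverse). -/
def powMod (M : ℕ) (b : ℤ) : ℤ → ℤ
  | Int.ofNat k => b ^ k
  | Int.negSucc k => Int.gcdA b M ^ (k + 1)

/-! Put p = n/(n,A). The relators of G vanish on a family x : ℤ/n → X exactly when y = (x, f) and
the translation t by A satisfy y^r t = t y^s in the wreath product of X with ℤ/n
(`forall_lift_wordM_eq_one_iff`). With v = t⁻¹ this says v y^r v⁻¹ = y^s. As v^p = 1, iteration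
gives y^(r^p) = y^(s^p), hence y^μ = 1, so y and v define a homomorphism from the finite split
metacyclic group H = ⟨y, v | y^μ, v^p, v y v⁻¹ = y^(s r̂)⟩. It lies over the fixed map ν : H → ℤ/n
with y ↦ f, v ↦ -A, and its first component is a cocycle on the action groupoid of H on ℤ/n, trivial
on U = ⟨v⟩. Thus G is the universal target of such cocycles (`groupM_mulEquiv_splitGroup`).

The components of this groupoid are the cosets of the image of ν, and every vertex group is ker ν.
As ν is injective on U, trivialising the arrows of U only contracts each U-orbit to a point. The
universal group is therefore the free product of one copy of ker ν per component and a free group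
whose rank is the number of U-orbits minus the number of components (`nonempty_mulEquiv_splitGroup`,
`card_freeIndex`). These numbers are (n,A) and (n,A,f).

It remains to see that ker ν is B(M,N,R,1) (`nonempty_beylGroup_mulEquiv_ker`). With n = gkdN, it is
generated by a = y^(kNc) and b = y^k v^(dj), and b^N is a power of y whose exponent is k times the
norm 1 + R + ⋯ + R^(N-1). By `exists_norm_modEq` the norm is N M/(M,R-1) up to a unit c, which the
choice of a absorbs. Both groups are then compared by order. -/

/-! ### Cocycles on an action groupoid. -/

section Cocycle

variable {H Z X Y : Type*} [Group H] [CommGroup Z] [Group X] [Group Y]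

/-- A cocycle on the action groupoid of `H` acting on `Z` by translation through `ν`. -/
def IsCocycle (ν : H →* Z) (φ : H → Z → X) : Prop :=
  ∀ g h z, φ (g * h) z = φ g z * φ h (z * ν g)

theorem IsCocycle.one {ν : H →* Z} {φ : H → Z → X} (hφ : IsCocycle ν φ) (z : Z) : φ 1 z = 1 := by
  have h := hφ 1 1 z
  simpa using h

theorem IsCocycle.inv {ν : H →* Z} {φ : H → Z → X} (hφ : IsCocycle ν φ) (g : H) (z : Z) :
    φ g⁻¹ (z * ν g) = (φ g z)⁻¹ := by
  have h := hφ g g⁻¹ z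
  rw [mul_inv_cancel, hφ.one] at h
  exact (inv_eq_of_mul_eq_one_right h.symm).symm

theorem IsCocycle.mul_inv {ν : H →* Z} {φ : H → Z → X} (hφ : IsCocycle ν φ) (g h : H) (z w : Z)
    (hw : w * ν h = z * ν g) : φ (g * h⁻¹) z = φ g z * (φ h w)⁻¹ := by
  rw [hφ, ← hw, hφ.inv]

theorem IsCocycle.comp {ν : H →* Z} {φ : H → Z → X} (hφ : IsCocycle ν φ) (F : X →* Y) :
    IsCocycle ν fun h z => F (φ h z) := fun g h z => by
  change F _ = F _ * F _
  rw [hφ, map_mul]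

end Cocycle

/-! ### Base vertices, U-orbits and an equivariant transversal. -/

section Transversal

variable {H Z : Type} [Group H] [CommGroup Z] (ν : H →* Z) (U : Subgroup H)

/-- The base vertex of the component of `z`. -/
noncomputable def baseVertex (c : Z ⧸ ν.range) : Z := c.out

theorem mk_baseVertex (c : Z ⧸ ν.range) : ((baseVertex ν c : Z) : Z ⧸ ν.range) = c :=
  Quotient.out_eq' c

theorem mk_mul_apply (z : Z) (h : H) : ((z * ν h : Z) : Z ⧸ ν.range) = z :=
  (QuotientGroup.mk_mul_of_mem z ⟨h, rfl⟩)

theorem exists_baseVertex_mul (z : Z) : ∃ h : H, baseVertex ν (z : Z ⧸ ν.range) * ν h = z := by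
  have h := mk_baseVertex ν (z : Z ⧸ ν.range)
  rw [QuotientGroup.eq] at h
  obtain ⟨x, hx⟩ := h
  exact ⟨x, by rw [hx]; simp⟩

open Classical in
/-- The representative of the `U`-orbit of `z`; it is the base vertex if that lies in the orbit. -/
noncomputable def orbitRep (z : Z) : Z :=
  if ((baseVertex ν (z : Z ⧸ ν.range) : Z) : Z ⧸ U.map ν) = z then baseVertex ν (z : Z ⧸ ν.range)
  else (z : Z ⧸ U.map ν).out

theorem mk_orbitRep (z : Z) : ((orbitRep ν U z : Z) : Z ⧸ U.map ν) = z := by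
  unfold orbitRep
  split_ifs with h
  · exact h
  · exact Quotient.out_eq' _

theorem exists_orbitRep_mul (z : Z) : ∃ v ∈ U, orbitRep ν U z * ν v = z := by
  have h := mk_orbitRep ν U z
  rw [QuotientGroup.eq] at h
  obtain ⟨x, hx, hxz⟩ := h
  exact ⟨x, hx, by rw [hxz]; simp⟩

theorem orbitRep_congr {z w : Z} (h : (z : Z ⧸ U.map ν) = w) : orbitRep ν U z = orbitRep ν U w := by
  have h2 : (z : Z ⧸ ν.range) = w := by
    rw [QuotientGroup.eq] at h ⊢
    obtain ⟨x, -, hx⟩ := h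
    exact ⟨x, hx⟩
  unfold orbitRep
  rw [h, h2]

theorem mk_mul_apply_of_mem (z : Z) {v : H} (hv : v ∈ U) :
    ((z * ν v : Z) : Z ⧸ U.map ν) = z :=
  QuotientGroup.mk_mul_of_mem z ⟨v, hv, rfl⟩

theorem orbitRep_mul (z : Z) {v : H} (hv : v ∈ U) :
    orbitRep ν U (z * ν v) = orbitRep ν U z :=
  orbitRep_congr ν U (mk_mul_apply_of_mem ν U z hv)

theorem orbitRep_orbitRep (z : Z) : orbitRep ν U (orbitRep ν U z) = orbitRep ν U z :=
  orbitRep_congr ν U (mk_orbitRep ν U z)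

theorem orbitRep_baseVertex (c : Z ⧸ ν.range) :
    orbitRep ν U (baseVertex ν c) = baseVertex ν c := by
  unfold orbitRep
  rw [mk_baseVertex, if_pos rfl]

theorem component_orbitRep (z : Z) : ((orbitRep ν U z : Z) : Z ⧸ ν.range) = z := by
  obtain ⟨v, -, h⟩ := exists_orbitRep_mul ν U z
  conv_rhs => rw [← h]
  exact (mk_mul_apply ν _ v).symm

open Classical in
/-- An element of `H` leading from the base vertex to `z`. -/
noncomputable def arrowTo (z : Z) : H :=
  -- The value 1 at the base vertex makes the transversal trivial there, so loops at the base vertex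
  -- are not conjugated.
  if z = baseVertex ν (z : Z ⧸ ν.range) then 1 else (exists_baseVertex_mul ν z).choose

theorem baseVertex_mul_arrowTo (z : Z) :
    baseVertex ν (z : Z ⧸ ν.range) * ν (arrowTo ν z) = z := by
  unfold arrowTo
  split_ifs with h
  · rw [map_one, mul_one, ← h]
  · exact (exists_baseVertex_mul ν z).choose_spec

/-- The element of `U` leading from the orbit representative to `z`. -/
noncomputable def orbitArrow (z : Z) : H := (exists_orbitRep_mul ν U z).choose

theorem orbitArrow_mem (z : Z) : orbitArrow ν U z ∈ U :=
  (exists_orbitRep_mul ν U z).choose_spec.1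

theorem orbitRep_mul_orbitArrow (z : Z) : orbitRep ν U z * ν (orbitArrow ν U z) = z :=
  (exists_orbitRep_mul ν U z).choose_spec.2

/-- A transversal of the translation action, equivariant under `U`. -/
noncomputable def transversal (z : Z) : H :=
  arrowTo ν (orbitRep ν U z) * orbitArrow ν U z

theorem baseVertex_mul_transversal (z : Z) :
    baseVertex ν (z : Z ⧸ ν.range) * ν (transversal ν U z) = z := by
  have h1 := baseVertex_mul_arrowTo ν (orbitRep ν U z)
  have h2 := orbitRep_mul_orbitArrow ν U z
  rw [component_orbitRep] at h1
  rw [transversal, map_mul, ← mul_assoc, h1, h2]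

variable {U} in
theorem eq_of_map_eq {ν : H →* Z} (hU : ∀ v ∈ U, ν v = 1 → v = 1) {v w : H} (hv : v ∈ U)
    (hw : w ∈ U) (h : ν v = ν w) : v = w := by
  have := hU (v * w⁻¹) (U.mul_mem hv (U.inv_mem hw)) (by simp [h])
  exact mul_inv_eq_one.mp this

/-- Injectivity of ν on U makes the arrow of U between two points of an orbit unique. This
equivariance is what makes arrows of U give trivial loops. -/
theorem transversal_mul (hU : ∀ v ∈ U, ν v = 1 → v = 1) (z : Z) {v : H} (hv : v ∈ U) :
    transversal ν U (z * ν v) = transversal ν U z * v := by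
  rw [transversal, transversal, orbitRep_mul ν U z hv, mul_assoc]
  congr 1
  refine eq_of_map_eq hU (orbitArrow_mem ν U _) (U.mul_mem (orbitArrow_mem ν U z) hv) ?_
  have h := orbitRep_mul_orbitArrow ν U (z * ν v)
  rw [orbitRep_mul ν U z hv] at h
  refine mul_left_cancel (a := orbitRep ν U z) ?_
  rw [h, map_mul, ← mul_assoc, orbitRep_mul_orbitArrow]

theorem transversal_baseVertex (hU : ∀ v ∈ U, ν v = 1 → v = 1) (c : Z ⧸ ν.range) :
    transversal ν U (baseVertex ν c) = 1 := by
  rw [transversal, orbitRep_baseVertex, arrowTo, if_pos (by rw [mk_baseVertex]), one_mul]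
  refine hU _ (orbitArrow_mem ν U _) ?_
  have h := orbitRep_mul_orbitArrow ν U (baseVertex ν c)
  rw [orbitRep_baseVertex] at h
  simpa using h

end Transversal

/-! ### The universal group of the groupoid with the arrows of U trivialised. -/

section Universal

variable {H Z G : Type} [Group H] [CommGroup Z] [Group G] (ν : H →* Z) (U : Subgroup H)

/-- The orbit representatives other than the base vertices. -/
def FreeIndex : Type :=
  {z : Z // orbitRep ν U z = z ∧ z ≠ baseVertex ν (z : Z ⧸ ν.range)}

/-- The vertex groups of the components together with a free group. -/
abbrev SplitGroup : Type :=
  Monoid.Coprod (Monoid.CoprodI fun _ : Z ⧸ ν.range => ν.ker) (FreeGroup (FreeIndex ν U))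

open Classical in
/-- The free generator attached to the orbit of `z`, trivial if the orbit has a base vertex. -/
noncomputable def orbitLabel (z : Z) : FreeGroup (FreeIndex ν U) :=
  if h : orbitRep ν U z = baseVertex ν (z : Z ⧸ ν.range) then 1
  else FreeGroup.of ⟨orbitRep ν U z, orbitRep_orbitRep ν U z, by rwa [component_orbitRep]⟩

theorem orbitLabel_mul (z : Z) {v : H} (hv : v ∈ U) :
    orbitLabel ν U (z * ν v) = orbitLabel ν U z := by
  have h1 := orbitRep_mul ν U z hv
  have h2 := mk_mul_apply ν z v
  unfold orbitLabel
  by_cases h : orbitRep ν U z = baseVertex ν (z : Z ⧸ ν.range)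
  · rw [dif_pos h, dif_pos (by rw [h1, h2, h])]
  · rw [dif_neg h, dif_neg (by rwa [h1, h2])]
    congr 1
    exact Subtype.ext h1

theorem orbitLabel_baseVertex (c : Z ⧸ ν.range) : orbitLabel ν U (baseVertex ν c) = 1 := by
  unfold orbitLabel
  rw [dif_pos]
  rw [orbitRep_baseVertex, mk_baseVertex]

theorem orbitLabel_freeIndex (l : FreeIndex ν U) : orbitLabel ν U l.1 = FreeGroup.of l := by
  unfold orbitLabel
  rw [dif_neg (by rw [l.2.1]; exact l.2.2)]
  congr 1
  exact Subtype.ext l.2.1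

/-- The loop at the base vertex obtained from the arrow `h` at `z`. -/
noncomputable def loopAt (h : H) (z : Z) : ν.ker :=
  ⟨transversal ν U z * h * (transversal ν U (z * ν h))⁻¹, by
    have h1 := baseVertex_mul_transversal ν U z
    have h2 := baseVertex_mul_transversal ν U (z * ν h)
    rw [mk_mul_apply] at h2
    rw [MonoidHom.mem_ker, map_mul, map_mul, map_inv, mul_inv_eq_one]
    refine mul_left_cancel (a := baseVertex ν (z : Z ⧸ ν.range)) ?_
    rw [h2, ← mul_assoc, h1]⟩

theorem loopAt_mul (g h : H) (z : Z) :
    loopAt ν U (g * h) z = loopAt ν U g z * loopAt ν U h (z * ν g) := by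
  apply Subtype.ext
  simp only [loopAt, Subgroup.coe_mul, map_mul, mul_assoc]
  simp

/-- The tautological cocycle with values in `SplitGroup`. -/
noncomputable def splitCocycle (h : H) (z : Z) : SplitGroup ν U :=
  (Monoid.Coprod.inr (orbitLabel ν U z))⁻¹ *
    Monoid.Coprod.inl (Monoid.CoprodI.of (M := fun _ : Z ⧸ ν.range => ν.ker)
      (i := (z : Z ⧸ ν.range)) (loopAt ν U h z)) *
    Monoid.Coprod.inr (orbitLabel ν U (z * ν h))

theorem isCocycle_splitCocycle : IsCocycle ν (splitCocycle ν U) := by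
  intro g h z
  simp only [splitCocycle, loopAt_mul, mk_mul_apply, map_mul, mul_assoc]
  simp

theorem splitCocycle_of_mem (hU : ∀ v ∈ U, ν v = 1 → v = 1) {v : H} (hv : v ∈ U) (z : Z) :
    splitCocycle ν U v z = 1 := by
  have h : loopAt ν U v z = 1 := by
    apply Subtype.ext
    simp [loopAt, transversal_mul ν U hU z hv]
  rw [splitCocycle, h, orbitLabel_mul ν U z hv]
  simp

/-- The homomorphism from `SplitGroup` induced by a cocycle. -/
noncomputable def splitLift {φ : H → Z → G} (hφ : IsCocycle ν φ) : SplitGroup ν U →* G :=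
  Monoid.Coprod.lift
    (Monoid.CoprodI.lift fun c => MonoidHom.mk' (fun k : ν.ker => φ k (baseVertex ν c))
      fun a b => by
        have ha : ν a = 1 := a.2
        simp [hφ (a : H) b, ha])
    (FreeGroup.lift fun l => φ (transversal ν U l.1) (baseVertex ν (l.1 : Z ⧸ ν.range)))

/-- Since φ is trivial on U, its value on the transversal depends only on the orbit; on the orbit of
a base vertex it is 1, matching the trivial label. -/
theorem splitLift_orbitLabel (hU : ∀ v ∈ U, ν v = 1 → v = 1) {φ : H → Z → G}
    (hφ : IsCocycle ν φ) (hφU : ∀ v ∈ U, ∀ z, φ v z = 1) (z : Z) :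
    splitLift ν U hφ (Monoid.Coprod.inr (orbitLabel ν U z)) =
      φ (transversal ν U z) (baseVertex ν (z : Z ⧸ ν.range)) := by
  obtain ⟨v, hv, hz⟩ := exists_orbitRep_mul ν U z
  have h1 : transversal ν U z = transversal ν U (orbitRep ν U z) * v := by
    rw [← transversal_mul ν U hU _ hv, hz]
  rw [h1, hφ, hφU v hv, mul_one]
  by_cases h : orbitRep ν U z = baseVertex ν (z : Z ⧸ ν.range)
  · have h2 : orbitLabel ν U z = 1 := dif_pos h
    rw [h2, h, transversal_baseVertex ν U hU, hφ.one]
    simp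
  · let l : FreeIndex ν U :=
      ⟨orbitRep ν U z, orbitRep_orbitRep ν U z, by rwa [component_orbitRep]⟩
    have h2 : orbitLabel ν U z = FreeGroup.of l := dif_neg h
    rw [h2, ← component_orbitRep ν U z]
    simp only [splitLift, Monoid.Coprod.lift_apply_inr]
    exact FreeGroup.lift_apply_of

theorem splitLift_splitCocycle (hU : ∀ v ∈ U, ν v = 1 → v = 1) {φ : H → Z → G}
    (hφ : IsCocycle ν φ) (hφU : ∀ v ∈ U, ∀ z, φ v z = 1) (h : H) (z : Z) :
    splitLift ν U hφ (splitCocycle ν U h z) = φ h z := by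
  rw [splitCocycle, map_mul, map_mul, map_inv, splitLift_orbitLabel ν U hU hφ hφU,
    splitLift_orbitLabel ν U hU hφ hφU, mk_mul_apply]
  have h1 := baseVertex_mul_transversal ν U z
  have h2 := baseVertex_mul_transversal ν U (z * ν h)
  rw [mk_mul_apply] at h2
  have h3 : splitLift ν U hφ (Monoid.Coprod.inl (Monoid.CoprodI.of
      (M := fun _ : Z ⧸ ν.range => ν.ker) (i := (z : Z ⧸ ν.range)) (loopAt ν U h z))) =
      φ (transversal ν U z * h * (transversal ν U (z * ν h))⁻¹)
        (baseVertex ν (z : Z ⧸ ν.range)) := by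
    simp [splitLift, loopAt]
  rw [h3, hφ.mul_inv _ _ _ (baseVertex ν (z : Z ⧸ ν.range)), hφ, h1]
  · group
  · rw [h2, map_mul, ← mul_assoc, h1]

/-- A group that is universal among the targets of cocycles trivial on `U` splits as the free
product of the vertex groups and a free group. -/
theorem nonempty_mulEquiv_splitGroup (hU : ∀ v ∈ U, ν v = 1 → v = 1) {φ : H → Z → G}
    (hφ : IsCocycle ν φ) (hφU : ∀ v ∈ U, ∀ z, φ v z = 1)
    (hlift : ∀ {X : Type} [Group X] (ψ : H → Z → X), IsCocycle ν ψ →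
      (∀ v ∈ U, ∀ z, ψ v z = 1) → ∃ F : G →* X, ∀ h z, F (φ h z) = ψ h z)
    (hext : ∀ F : G →* G, (∀ h z, F (φ h z) = φ h z) → F = MonoidHom.id G) :
    Nonempty (G ≃* SplitGroup ν U) := by
  obtain ⟨F, hF⟩ := hlift (splitCocycle ν U) (isCocycle_splitCocycle ν U)
    fun v hv z => splitCocycle_of_mem ν U hU hv z
  refine ⟨MonoidHom.toMulEquiv F (splitLift ν U hφ) (hext _ fun h z => ?_) ?_⟩
  · rw [MonoidHom.comp_apply, hF, splitLift_splitCocycle ν U hU hφ hφU]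
  · apply Monoid.Coprod.hom_ext
    · apply Monoid.CoprodI.ext_hom
      intro c
      ext k
      have hk : ν k = 1 := k.2
      -- Transversal and label are trivial at both ends of a loop at the base vertex, so the cocycle
      -- there is the inclusion of the vertex group.
      have h3 : loopAt ν U k (baseVertex ν c) = k := by
        apply Subtype.ext
        simp [loopAt, hk, transversal_baseVertex ν U hU]
      have h4 : splitCocycle ν U k (baseVertex ν c) = Monoid.Coprod.inl (Monoid.CoprodI.of
          (M := fun _ : Z ⧸ ν.range => ν.ker) (i := c) k) := by
        rw [splitCocycle, h3, hk, mul_one, orbitLabel_baseVertex, mk_baseVertex]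
        simp
      simp [splitLift, hF, h4]
    · ext l
      have h2 := baseVertex_mul_transversal ν U l.1
      -- Along a transversal arrow the loop part cancels and only the label of the endpoint
      -- survives.
      have h3 : loopAt ν U (transversal ν U l.1) (baseVertex ν (l.1 : Z ⧸ ν.range)) = 1 := by
        apply Subtype.ext
        simp [loopAt, h2, transversal_baseVertex ν U hU]
      have h4 : splitCocycle ν U (transversal ν U l.1) (baseVertex ν (l.1 : Z ⧸ ν.range)) =
          Monoid.Coprod.inr (FreeGroup.of l) := by
        rw [splitCocycle, h3, h2, orbitLabel_baseVertex, orbitLabel_freeIndex]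
        simp
      simp [splitLift, hF, h4]

/-- Representatives correspond to orbits and base vertices to components; every base vertex is a
representative, so the cardinalities subtract. -/
theorem card_freeIndex [Finite Z] :
    Nat.card (FreeIndex ν U) = Nat.card (Z ⧸ U.map ν) - Nat.card (Z ⧸ ν.range) := by
  have e1 : (Z ⧸ U.map ν) ≃ {z : Z // orbitRep ν U z = z} :=
    { toFun := fun q => ⟨orbitRep ν U q.out, orbitRep_orbitRep ν U _⟩
      invFun := fun z => (z.1 : Z ⧸ U.map ν)
      left_inv := fun q => (mk_orbitRep ν U _).trans (Quotient.out_eq' q)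
      right_inv := fun z => Subtype.ext <| by
        refine Eq.trans (orbitRep_congr ν U ?_) z.2
        exact Quotient.out_eq' _ }
  have e2 : (Z ⧸ ν.range) ≃ {z : Z // z = baseVertex ν (z : Z ⧸ ν.range)} :=
    { toFun := fun c => ⟨baseVertex ν c, by rw [mk_baseVertex]⟩
      invFun := fun z => (z.1 : Z ⧸ ν.range)
      left_inv := fun c => mk_baseVertex ν c
      right_inv := fun z => Subtype.ext z.2.symm }
  rw [Nat.card_congr e1, Nat.card_congr e2]
  have hsub : {z : Z | z = baseVertex ν (z : Z ⧸ ν.range)} ⊆ {z | orbitRep ν U z = z} := by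
    intro z hz
    rw [Set.mem_ofPred_eq] at hz ⊢
    rw [hz, orbitRep_baseVertex]
  have := Set.ncard_sdiff hsub (Set.toFinite _)
  exact this

end Universal

/-! ### Homomorphisms from cyclic groups and powers under conjugation. -/

section CyclicHom

variable {X : Type*} [Group X]

/-- The homomorphism from the cyclic group of order `m` determined by `x` with `x ^ m = 1`. -/
noncomputable def zmodPowHom (m : ℕ) (x : X) (hx : x ^ m = 1) : Multiplicative (ZMod m) →* X :=
  AddMonoidHom.toMultiplicativeLeft (ZMod.lift m ⟨zmultiplesHom (Additive X) (Additive.ofMul x), by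
    change ((m : ℤ) • Additive.ofMul x) = 0
    rw [natCast_zsmul, ← ofMul_pow, hx, ofMul_one]⟩)

theorem zmodPowHom_ofAdd_intCast (m : ℕ) (x : X) (hx : x ^ m = 1) (z : ℤ) :
    zmodPowHom m x hx (Multiplicative.ofAdd (z : ZMod m)) = x ^ z := by
  simp [zmodPowHom]

theorem zpow_eq_zpow_of_modEq {x : X} {m : ℕ} (hx : x ^ m = 1) {a b : ℤ} (h : a ≡ b [ZMOD m]) :
    x ^ a = x ^ b := by
  obtain ⟨c, hc⟩ := h.dvd
  rw [show b = a + m * c by linarith, zpow_add, zpow_mul, zpow_natCast, hx, one_zpow, mul_one]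

theorem conj_pow_zpow {y v : X} {S : ℤ} (h : v * y * v⁻¹ = y ^ S) (x : ℕ) (z : ℤ) :
    v ^ x * y ^ z * (v ^ x)⁻¹ = y ^ (S ^ x * z) := by
  induction x generalizing z with
  | zero => simp
  | succ x ih =>
    have h1 : v * y ^ z * v⁻¹ = y ^ (S * z) := by
      rw [← conj_zpow, h, zpow_mul]
    calc v ^ (x + 1) * y ^ z * (v ^ (x + 1))⁻¹ = v ^ x * (v * y ^ z * v⁻¹) * (v ^ x)⁻¹ := by
          rw [pow_succ]; group
      _ = _ := by rw [h1, ih, pow_succ, mul_assoc]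

end CyclicHom

/-! ### The split metacyclic group and its universal property. -/

section Metacyclic

variable (μ p : ℕ) (S : (ZMod μ)ˣ) (hS : S ^ p = 1)

/-- The action of the cyclic group of order `p` on the one of order `μ` through the unit `S`. -/
noncomputable def unitAction : Multiplicative (ZMod p) →* MulAut (Multiplicative (ZMod μ)) :=
  ((MulAutMultiplicative (ZMod μ)).symm.toMonoidHom.comp AddAut.mulLeft).comp (zmodPowHom p S hS)

theorem unitAction_ofAdd (x : ℕ) (z : ZMod μ) :
    unitAction μ p S hS (Multiplicative.ofAdd (x : ZMod p)) (Multiplicative.ofAdd z) =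
      Multiplicative.ofAdd (((S ^ x : (ZMod μ)ˣ) : ZMod μ) * z) := by
  have := zmodPowHom_ofAdd_intCast p S hS (x : ℤ)
  rw [Int.cast_natCast, zpow_natCast] at this
  simp only [unitAction, MonoidHom.comp_apply, this]
  rfl

/-- The split metacyclic group in which the generator of `ZMod p` acts as the unit `S`. -/
abbrev SplitMetacyclic : Type :=
  Multiplicative (ZMod μ) ⋊[unitAction μ p S hS] Multiplicative (ZMod p)

namespace SplitMetacyclic

/-- The generator of the normal factor. -/
noncomputable def genY : SplitMetacyclic μ p S hS := SemidirectProduct.inl (Multiplicative.ofAdd 1)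

/-- The generator of the complement. -/
noncomputable def genV : SplitMetacyclic μ p S hS := SemidirectProduct.inr (Multiplicative.ofAdd 1)

theorem genY_zpow (z : ℤ) :
    genY μ p S hS ^ z = SemidirectProduct.inl (Multiplicative.ofAdd (z : ZMod μ)) := by
  rw [genY, ← map_zpow, ← ofAdd_zsmul]; simp

theorem genV_zpow (z : ℤ) :
    genV μ p S hS ^ z = SemidirectProduct.inr (Multiplicative.ofAdd (z : ZMod p)) := by
  rw [genV, ← map_zpow, ← ofAdd_zsmul]; simp

theorem genY_pow_card : genY μ p S hS ^ μ = 1 := by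
  rw [← zpow_natCast, genY_zpow]; simp

theorem genV_pow_card : genV μ p S hS ^ p = 1 := by
  rw [← zpow_natCast, genV_zpow]; simp

theorem exists_eq_zpow_mul_zpow (h : SplitMetacyclic μ p S hS) :
    ∃ z x : ℤ, h = genY μ p S hS ^ z * genV μ p S hS ^ x := by
  obtain ⟨z, hz⟩ := ZMod.intCast_surjective (Multiplicative.toAdd h.left)
  obtain ⟨x, hx⟩ := ZMod.intCast_surjective (Multiplicative.toAdd h.right)
  refine ⟨z, x, ?_⟩
  rw [genY_zpow, genV_zpow, hz, hx]
  simp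

theorem genV_conj_genY {T : ℤ} (hT : (S : ZMod μ) = T) :
    genV μ p S hS * genY μ p S hS * (genV μ p S hS)⁻¹ = genY μ p S hS ^ T := by
  have h := unitAction_ofAdd μ p S hS 1 1
  rw [genY_zpow, genV, genY, ← map_inv, ← SemidirectProduct.inl_aut]
  rw [Nat.cast_one, pow_one, mul_one, hT] at h
  rw [h]

variable {X : Type*} [Group X]

theorem hom_ext {F F' : SplitMetacyclic μ p S hS →* X}
    (hy : F (genY μ p S hS) = F' (genY μ p S hS)) (hv : F (genV μ p S hS) = F' (genV μ p S hS)) :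
    F = F' := by
  ext h
  obtain ⟨z, x, rfl⟩ := exists_eq_zpow_mul_zpow μ p S hS h
  simp [hy, hv]

theorem exists_hom [NeZero p] {T : ℤ} (hT : (S : ZMod μ) = T) (y v : X) (hy : y ^ μ = 1)
    (hv : v ^ p = 1) (h : v * y * v⁻¹ = y ^ T) :
    ∃ F : SplitMetacyclic μ p S hS →* X, F (genY μ p S hS) = y ∧ F (genV μ p S hS) = v := by
  refine ⟨SemidirectProduct.lift (zmodPowHom μ y hy) (zmodPowHom p v hv) ?_, ?_, ?_⟩
  · intro g
    -- As p is nonzero the exponent of v may be taken natural, so compatibility with the action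
    -- follows by iterating the conjugation relation.
    obtain ⟨x, hx⟩ := ZMod.natCast_zmod_surjective (Multiplicative.toAdd g)
    obtain rfl : Multiplicative.ofAdd (x : ZMod p) = g := hx
    refine MonoidHom.ext fun w => ?_
    obtain ⟨z, hz⟩ := ZMod.intCast_surjective (Multiplicative.toAdd w)
    obtain rfl : Multiplicative.ofAdd (z : ZMod μ) = w := hz
    have h1 := zmodPowHom_ofAdd_intCast p v hv (x : ℤ)
    rw [Int.cast_natCast, zpow_natCast] at h1
    simp only [MonoidHom.comp_apply, MulEquiv.coe_toMonoidHom, MulAut.conj_apply]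
    rw [unitAction_ofAdd, h1, zmodPowHom_ofAdd_intCast, conj_pow_zpow h,
      ← zmodPowHom_ofAdd_intCast μ y hy]
    congr 2
    push_cast
    rw [hT]
  · have h1 := zmodPowHom_ofAdd_intCast μ y hy 1
    rw [Int.cast_one, zpow_one] at h1
    rw [genY, SemidirectProduct.lift_inl, h1]
  · have h1 := zmodPowHom_ofAdd_intCast p v hv 1
    rw [Int.cast_one, zpow_one] at h1
    rw [genV, SemidirectProduct.lift_inr, h1]

theorem card_eq : Nat.card (SplitMetacyclic μ p S hS) = μ * p := by
  rw [SemidirectProduct.card]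
  exact congrArg₂ _ (Nat.card_zmod μ) (Nat.card_zmod p)

end SplitMetacyclic

end Metacyclic

/-! ### Consequences of v y^r v⁻¹ = y^s. -/

section Relation

variable {X : Type*} [Group X]

theorem pow_mul_zpow_mul_inv {y v : X} {r s : ℤ} (h : v * y ^ r * v⁻¹ = y ^ s) (j : ℕ) :
    v ^ j * y ^ (r ^ j) * (v ^ j)⁻¹ = y ^ (s ^ j) := by
  induction j with
  | zero => simp
  | succ j ih =>
    calc v ^ (j + 1) * y ^ (r ^ (j + 1)) * (v ^ (j + 1))⁻¹
        = v * (v ^ j * y ^ (r ^ j) * (v ^ j)⁻¹) ^ r * v⁻¹ := by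
          rw [conj_zpow, ← zpow_mul, ← pow_succ, pow_succ']; group
      _ = (v * y ^ r * v⁻¹) ^ (s ^ j) := by
          rw [ih, conj_zpow, ← zpow_mul, ← zpow_mul, mul_comm]
      _ = _ := by rw [h, ← zpow_mul, pow_succ']

/-- Conjugation by v^p = 1 carries y^(r^p) to y^(s^p). This is where μ comes from. -/
theorem pow_natAbs_sub_eq_one {y v : X} {r s : ℤ} {p : ℕ} (hv : v ^ p = 1)
    (h : v * y ^ r * v⁻¹ = y ^ s) : y ^ (r ^ p - s ^ p).natAbs = 1 := by
  have h1 := pow_mul_zpow_mul_inv h p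
  rw [hv, one_mul, inv_one, mul_one] at h1
  have h2 : y ^ (r ^ p - s ^ p) = 1 := by rw [zpow_sub, h1, mul_inv_cancel]
  rw [← orderOf_dvd_iff_pow_eq_one]
  rw [← orderOf_dvd_iff_zpow_eq_one] at h2
  exact Int.natCast_dvd.mp h2

theorem conj_eq_zpow {y v : X} {r s rhat : ℤ} {μ : ℕ} (hy : y ^ μ = 1)
    (hr : r * rhat ≡ 1 [ZMOD μ]) (h : v * y ^ r * v⁻¹ = y ^ s) :
    v * y * v⁻¹ = y ^ (s * rhat) := by
  have h1 : y ^ (r * rhat) = y := by simpa using zpow_eq_zpow_of_modEq hy hr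
  rw [zpow_mul, ← h, conj_zpow, ← zpow_mul, h1]

theorem conj_zpow_eq_zpow {y v : X} {r s rhat : ℤ} {μ : ℕ} (hy : y ^ μ = 1)
    (hr : r * rhat ≡ 1 [ZMOD μ]) (h : v * y * v⁻¹ = y ^ (s * rhat)) :
    v * y ^ r * v⁻¹ = y ^ s := by
  rw [← conj_zpow, h, ← zpow_mul]
  apply zpow_eq_zpow_of_modEq hy
  have := hr.mul_left s
  rw [mul_one] at this
  exact (by ring : s * rhat * r = s * (r * rhat)) ▸ this

end Relation

/-! ### Cocycles as homomorphisms to a wreath product. -/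

section Translation

variable (Z X : Type) [CommGroup Z] [Group X]

/-- The action of `Z` on functions on `Z` by translation. -/
def translateAut : Z →* MulAut (Z → X) where
  toFun t :=
    { toFun := fun F z => F (z * t)
      invFun := fun F z => F (z * t⁻¹)
      left_inv := fun F => by funext z; simp
      right_inv := fun F => by funext z; simp
      map_mul' := fun _ _ => rfl }
  map_one' := by ext F z; simp
  map_mul' t t' := by ext F z; simp [mul_assoc]

theorem translateAut_apply (t : Z) (F : Z → X) (z : Z) : translateAut Z X t F z = F (z * t) := rfl

/-- The wreath product of `X` with `Z` acting on itself by translation. -/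
abbrev TranslationWreath : Type := (Z → X) ⋊[translateAut Z X] Z

variable {Z X} {H : Type} [Group H]

/-- A cocycle as a homomorphism to the wreath product. -/
def IsCocycle.toHom {ν : H →* Z} {φ : H → Z → X} (hφ : IsCocycle ν φ) :
    H →* TranslationWreath Z X :=
  MonoidHom.mk' (fun h => ⟨φ h, ν h⟩) fun g h => by
    ext z
    · exact hφ g h z
    · exact map_mul ν g h

theorem isCocycle_left (σ : H →* TranslationWreath Z X) {ν : H →* Z}
    (hν : ∀ h, (σ h).right = ν h) : IsCocycle ν fun h z => (σ h).left z := by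
  intro g h z
  change (σ (g * h)).left z = (σ g).left z * (σ h).left (z * ν g)
  rw [map_mul, SemidirectProduct.mul_left, hν]
  rfl

end Translation

/-! ### The defining word evaluated in the wreath product. -/

section Word

variable {X : Type} [Group X] (n : ℕ)

theorem shift_zpow_of (j : ℤ) (i : ZMod n) :
    (shift n ^ j) (FreeGroup.of i) = FreeGroup.of (i + (j : ZMod n)) := by
  induction j generalizing i with
  | zero => simp
  | succ j ih =>
    rw [zpow_add_one, MulAut.mul_apply]
    simp only [shift, FreeGroup.freeGroupCongr_apply, FreeGroup.map.of] at ih ⊢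
    rw [ih]
    congr 1
    simp only [Equiv.coe_addRight]
    push_cast
    ring
  | pred j ih =>
    have h : (shift n)⁻¹ (FreeGroup.of i) = FreeGroup.of (i - 1) := by
      apply (shift n).injective
      rw [MulAut.apply_inv_self]
      simp [shift]
    rw [zpow_sub_one, MulAut.mul_apply, h, ih]
    congr 1
    push_cast
    ring

theorem lift_shift_zpow (x : ZMod n → X) (j : ℤ) (w : FreeGroup (ZMod n)) :
    FreeGroup.lift x ((shift n ^ j) w) = FreeGroup.lift (fun i => x (i + (j : ZMod n))) w := by
  have h : (FreeGroup.lift x).comp (shift n ^ j).toMonoidHom =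
      FreeGroup.lift fun i => x (i + (j : ZMod n)) := by
    ext i
    simp [shift_zpow_of]
  exact DFunLike.congr_fun h w

/-- In `block` the bound variable is an integer, so the range is coerced through the list monad;
here the index is natural. -/
theorem block_eq (f : ℤ) (l : ℕ) :
    block n f l = ((List.range l).map fun i : ℕ =>
      FreeGroup.of ((((i : ℤ) * f : ℤ)) : ZMod n)).prod := by
  unfold block
  rw [bind_pure_comp, List.map_eq_map, List.map_map]
  rfl

theorem lift_block (x : ZMod n → X) (f : ℤ) (l : ℕ) (j : ℤ) :
    FreeGroup.lift x ((shift n ^ j) (block n f l)) =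
      ((List.range l).map fun i : ℕ => x ((((i : ℤ) * f : ℤ) : ZMod n) + (j : ZMod n))).prod := by
  rw [lift_shift_zpow, block_eq, map_list_prod, List.map_map]
  congr 2
  funext i
  simp

/-- The element `(x, f)` of the wreath product. -/
def wreathGen (x : ZMod n → X) (f : ℤ) :
    TranslationWreath (Multiplicative (ZMod n)) X :=
  ⟨fun z => x z.toAdd, Multiplicative.ofAdd (f : ZMod n)⟩

/-- The translation by `A` in the wreath product. -/
def wreathShift (A : ℤ) : TranslationWreath (Multiplicative (ZMod n)) X :=
  SemidirectProduct.inr (Multiplicative.ofAdd (A : ZMod n))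

theorem wreathGen_zpow_right (x : ZMod n → X) (f r : ℤ) :
    (wreathGen n x f ^ r).right = Multiplicative.ofAdd ((r * f : ℤ) : ZMod n) := by
  have h := map_zpow (SemidirectProduct.rightHom
    (φ := translateAut (Multiplicative (ZMod n)) X)) (wreathGen n x f) r
  simp only [SemidirectProduct.rightHom_eq_right] at h
  rw [h, wreathGen, ← ofAdd_zsmul]
  simp

theorem wreathGen_pow_left (x : ZMod n → X) (f : ℤ) (l : ℕ) (j : ℤ) :
    (wreathGen n x f ^ l).left (Multiplicative.ofAdd (j : ZMod n)) =
      FreeGroup.lift x ((shift n ^ j) (block n f l)) := by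
  rw [lift_block]
  induction l with
  | zero => simp
  | succ l ih =>
    have h := wreathGen_zpow_right n x f l
    rw [zpow_natCast] at h
    rw [pow_succ, SemidirectProduct.mul_left, Pi.mul_apply, ih, List.range_succ, h]
    simp only [List.map_append, List.prod_append, List.map_cons, List.map_nil, List.prod_cons,
      List.prod_nil, mul_one]
    congr 1
    rw [translateAut_apply, ← ofAdd_add, wreathGen]
    simp [add_comm]

theorem wreathGen_zpow_left (x : ZMod n → X) (f r j : ℤ) :
    (wreathGen n x f ^ r).left (Multiplicative.ofAdd (j : ZMod n)) =
      FreeGroup.lift x ((shift n ^ j) (intBlock n f r)) := by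
  unfold intBlock
  split_ifs with hr
  · obtain ⟨l, rfl⟩ := Int.eq_ofNat_of_zero_le hr
    rw [zpow_natCast, wreathGen_pow_left, Int.natAbs_natCast]
  · obtain ⟨l, rfl⟩ : ∃ l : ℕ, r = -(l : ℤ) := ⟨r.natAbs, by omega⟩
    have h := wreathGen_zpow_right n x f l
    rw [zpow_natCast] at h
    rw [zpow_neg, zpow_natCast, SemidirectProduct.inv_left, translateAut_apply, Pi.inv_apply, h,
      ← ofAdd_neg, ← ofAdd_add, map_inv, map_inv, ← MulAut.mul_apply, ← zpow_add,
      ← wreathGen_pow_left, Int.natAbs_neg, Int.natAbs_natCast]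
    have e : (j : ZMod n) + -(((l : ℤ) * f : ℤ) : ZMod n) = ((j + -(l : ℤ) * f : ℤ) : ZMod n) := by
      push_cast
      ring
    rw [e]

theorem shift_zpow_congr {a b : ℤ} (h : (a : ZMod n) = b) : shift n ^ a = shift n ^ b := by
  have h2 : (shift n ^ a).toMonoidHom = (shift n ^ b).toMonoidHom := by
    ext i
    simp [shift_zpow_of, h]
  ext w
  exact DFunLike.congr_fun h2 w

/-- For s < 0 the right-hand side carries the shift A + sf, which agrees with A + fr modulo n by
`hf`; so both signs have one form. -/
theorem wordM_eq (r s f A : ℤ) (hf : f * (r - s) ≡ 0 [ZMOD n]) :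
    wordM r n s f A = intBlock n f r * ((shift n ^ A) (intBlock n f s))⁻¹ := by
  unfold wordM
  split_ifs with hs
  · rw [intBlock, intBlock, if_pos hs]
  · congr 1
    conv_rhs => rw [intBlock, if_neg hs, map_inv, inv_inv, ← MulAut.mul_apply, ← zpow_add]
    rw [shift_zpow_congr]
    have := (ZMod.intCast_eq_intCast_iff _ _ _).mpr hf
    push_cast at this ⊢
    linear_combination this

theorem lift_wordM (x : ZMod n → X) (r s f A j : ℤ) (hf : f * (r - s) ≡ 0 [ZMOD n]) :
    FreeGroup.lift x ((shift n ^ j) (wordM r n s f A)) =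
      (wreathGen n x f ^ r * wreathShift n A).left (Multiplicative.ofAdd (j : ZMod n)) *
      ((wreathShift n A * wreathGen n x f ^ s).left (Multiplicative.ofAdd (j : ZMod n)))⁻¹ := by
  rw [wordM_eq n r s f A hf, map_mul, map_mul, map_inv, map_inv, ← MulAut.mul_apply, ← zpow_add,
    ← wreathGen_zpow_left, ← wreathGen_zpow_left]
  simp [wreathShift, translateAut_apply]

/-- The relators of `GroupM` vanish on `x` exactly if `y = (x, f)` and the translation by `A`
satisfy the relation of the shift extension. -/
theorem forall_lift_wordM_eq_one_iff (hn : 0 < n) (x : ZMod n → X) (r s f A : ℤ)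
    (hf : f * (r - s) ≡ 0 [ZMOD n]) :
    (∀ k : ℕ, k < n → FreeGroup.lift x ((shift n ^ k) (wordM r n s f A)) = 1) ↔
      wreathGen n x f ^ r * wreathShift n A = wreathShift n A * wreathGen n x f ^ s := by
  constructor
  · intro h
    apply SemidirectProduct.ext
    · funext z
      have : NeZero n := ⟨hn.ne'⟩
      have h1 := h z.toAdd.val (ZMod.val_lt _)
      rw [← zpow_natCast, lift_wordM n x r s f A _ hf, mul_inv_eq_one] at h1
      simpa using h1
    · rw [SemidirectProduct.mul_right, SemidirectProduct.mul_right, wreathGen_zpow_right,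
        wreathGen_zpow_right, wreathShift, SemidirectProduct.right_inr, ← ofAdd_add, ← ofAdd_add]
      congr 1
      have := (ZMod.intCast_eq_intCast_iff _ _ _).mpr hf
      push_cast at this ⊢
      linear_combination this
  · intro h k _
    rw [← zpow_natCast, lift_wordM n x r s f A _ hf, h, mul_inv_cancel]

end Word

/-! ### The cyclically presented group as a universal target of cocycles. -/

section Universal

/-- `GroupM` splits as a free product of copies of the kernel of the map to `ZMod n` from the split
metacyclic group `⟨y, v | v y ^ r v⁻¹ = y ^ s, v ^ p⟩`, and a free group. -/
theorem groupM_mulEquiv_splitGroup (r : ℤ) (n : ℕ) (s f A : ℤ) (hn : 0 < n)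
    (hf : f * (r - s) ≡ 0 [ZMOD n]) (μ p : ℕ) [NeZero p]
    (hμ : μ = (r ^ p - s ^ p).natAbs) (rhat : ℤ) (hrhat : r * rhat ≡ 1 [ZMOD μ])
    (hAp : ∀ x : ℤ, (n : ℤ) ∣ x * A ↔ (p : ℤ) ∣ x)
    (S : (ZMod μ)ˣ) (hS : S ^ p = 1) (hST : (S : ZMod μ) = ((s * rhat : ℤ) : ZMod μ))
    (ν : SplitMetacyclic μ p S hS →* Multiplicative (ZMod n))
    (hνy : ν (SplitMetacyclic.genY μ p S hS) = Multiplicative.ofAdd (f : ZMod n))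
    (hνv : ν (SplitMetacyclic.genV μ p S hS) = Multiplicative.ofAdd ((-A : ℤ) : ZMod n)) :
    Nonempty (GroupM r n s f A ≃*
      SplitGroup ν (Subgroup.zpowers (SplitMetacyclic.genV μ p S hS))) := by
  set y := SplitMetacyclic.genY μ p S hS with hy_def
  set v := SplitMetacyclic.genV μ p S hS with hv_def
  have hyμ : y ^ μ = 1 := SplitMetacyclic.genY_pow_card μ p S hS
  have hvp : v ^ p = 1 := SplitMetacyclic.genV_pow_card μ p S hS
  have hrel : v * y ^ r * v⁻¹ = y ^ s :=
    conj_zpow_eq_zpow hyμ hrhat (SplitMetacyclic.genV_conj_genY μ p S hS hST)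
  let x₀ : ZMod n → GroupM r n s f A := fun i => PresentedGroup.of i
  have hx₀ : ∀ k : ℕ, k < n → FreeGroup.lift x₀ ((shift n ^ k) (wordM r n s f A)) = 1 := by
    intro k hk
    have h1 : (PresentedGroup.mk _ ((shift n ^ k) (wordM r n s f A)) : GroupM r n s f A) = 1 :=
      PresentedGroup.one_of_mem ⟨k, hk, rfl⟩
    have h2 : FreeGroup.lift x₀ = PresentedGroup.mk _ := by
      ext i
      simp [x₀, PresentedGroup.of]
    rw [h2, h1]
  rw [forall_lift_wordM_eq_one_iff n hn x₀ r s f A hf] at hx₀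
  -- The generator v is matched with the inverse of the translation by A, whence the sign in `hνv`.
  have hconj : ∀ {X : Type} [Group X] {a b : X}, a ^ r * b = b * a ^ s ↔
      b⁻¹ * a ^ r * b⁻¹⁻¹ = a ^ s := by
    intro X _ a b
    rw [inv_inv, mul_assoc, inv_mul_eq_iff_eq_mul]
  have hsh : ∀ {X : Type} [Group X] (t : ℤ),
      (wreathShift n A : TranslationWreath (Multiplicative (ZMod n)) X) ^ t =
        SemidirectProduct.inr (Multiplicative.ofAdd ((t * A : ℤ) : ZMod n)) := by
    intro X _ t
    rw [wreathShift, ← map_zpow, ← ofAdd_zsmul]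
    simp
  have hwp : (wreathShift n A : TranslationWreath (Multiplicative (ZMod n))
      (GroupM r n s f A))⁻¹ ^ p = 1 := by
    have h := (ZMod.intCast_zmod_eq_zero_iff_dvd _ _).mpr ((hAp p).mpr dvd_rfl)
    rw [inv_pow, ← zpow_natCast, hsh, h]
    simp
  have hrel₀ := hconj.mp hx₀
  have hyμ₀ := pow_natAbs_sub_eq_one hwp hrel₀
  rw [← hμ] at hyμ₀
  obtain ⟨σ, hσy, hσv⟩ := SplitMetacyclic.exists_hom μ p S hS hST _ _ hyμ₀ hwp
    (conj_eq_zpow hyμ₀ hrhat hrel₀)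
  have hσν : ∀ h, (σ h).right = ν h := by
    have : SemidirectProduct.rightHom.comp σ = ν := by
      apply SplitMetacyclic.hom_ext
      · rw [MonoidHom.comp_apply, hσy, ← hy_def, hνy]
        rfl
      · rw [MonoidHom.comp_apply, hσv, ← hv_def, hνv]
        simp [wreathShift]
    exact fun h => DFunLike.congr_fun this h
  have hφ := isCocycle_left σ hσν
  refine nonempty_mulEquiv_splitGroup ν _ ?_ hφ ?_ ?_ ?_
  · rintro _ ⟨t, rfl⟩ ht
    change ν (v ^ t) = 1 at ht
    change v ^ t = 1
    rw [map_zpow, hνv, ← ofAdd_zsmul, ← ofAdd_zero] at ht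
    have h1 := Multiplicative.ofAdd.injective ht
    rw [zsmul_eq_mul, ← Int.cast_mul, ZMod.intCast_zmod_eq_zero_iff_dvd, mul_neg, dvd_neg,
      hAp] at h1
    obtain ⟨c, rfl⟩ := h1
    rw [zpow_mul, zpow_natCast, hvp, one_zpow]
  · rintro _ ⟨t, rfl⟩ z
    change (σ (v ^ t)).left z = 1
    rw [map_zpow, hσv, inv_zpow', hsh]
    simp
  -- The values of ψ at y form the family x; triviality on U forces v to a pure translation, so the
  -- relation in H becomes the vanishing of the relators on x.
  · intro X _ ψ hψ hψU
    let x : ZMod n → X := fun i => ψ y (Multiplicative.ofAdd i)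
    have h1 : hψ.toHom y = wreathGen n x f := by
      apply SemidirectProduct.ext
      · rfl
      · exact hνy
    have h2 : hψ.toHom v = (wreathShift n A)⁻¹ := by
      rw [← zpow_neg_one, hsh]
      apply SemidirectProduct.ext
      · funext z
        exact hψU v (Subgroup.mem_zpowers v) z
      · exact hνv.trans (by simp)
    have h3 := congrArg hψ.toHom hrel
    rw [map_mul, map_mul, map_inv, map_zpow, map_zpow, h1, h2] at h3
    have h4 := (forall_lift_wordM_eq_one_iff n hn x r s f A hf).mpr (hconj.mpr h3)
    refine ⟨PresentedGroup.toGroup (f := x) ?_, ?_⟩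
    · rintro _ ⟨k, hk, rfl⟩
      exact h4 k hk
    · set F : GroupM r n s f A →* X := PresentedGroup.toGroup (f := x) _ with hF
      have h5 : (hφ.comp F).toHom = hψ.toHom := by
        apply SplitMetacyclic.hom_ext
        · rw [← hy_def, h1]
          apply SemidirectProduct.ext
          · funext z
            change F ((σ y).left z) = _
            rw [hσy]
            exact PresentedGroup.toGroup.of _
          · exact hνy
        · rw [← hv_def, h2, ← zpow_neg_one, hsh]
          apply SemidirectProduct.ext
          · funext z
            change F ((σ v).left z) = _
            rw [hσv, ← zpow_neg_one, hsh]
            simp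
          · exact hνv.trans (by simp)
      intro h z
      exact congrFun (congrArg SemidirectProduct.left (DFunLike.congr_fun h5 h)) z
  -- The cocycle at y takes the generators of G as its values.
  · intro F hF
    apply PresentedGroup.ext
    intro i
    have h1 := hF y (Multiplicative.ofAdd i)
    rw [hσy] at h1
    exact h1

end Universal

/-! ### Structure and order bound for B(M,N,R,l). -/

section Beyl

variable {M N : ℕ} {R l : ℤ}

theorem beyl_pow_eq_one : (PresentedGroup.of 0 : BeylGroup M N R l) ^ M = 1 := by
  have h : (PresentedGroup.mk (beylRels M N R l) (FreeGroup.of 0 ^ M)) = 1 :=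
    PresentedGroup.one_of_mem (Or.inl rfl)
  rwa [map_pow] at h

theorem beyl_conj : (PresentedGroup.of 1 : BeylGroup M N R l) * PresentedGroup.of 0 *
    (PresentedGroup.of 1)⁻¹ = PresentedGroup.of 0 ^ R := by
  have h : (PresentedGroup.mk (beylRels M N R l) (FreeGroup.of 1 * FreeGroup.of 0 *
      (FreeGroup.of 1)⁻¹ * (FreeGroup.of 0 ^ R)⁻¹)) = 1 :=
    PresentedGroup.one_of_mem (Or.inr (Or.inl rfl))
  rw [map_mul, map_inv, mul_inv_eq_one, map_zpow] at h
  rw [map_mul, map_mul, map_inv] at h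
  exact h

theorem beyl_pow_eq : (PresentedGroup.of 1 : BeylGroup M N R l) ^ N =
    PresentedGroup.of 0 ^ (l * ((M / Int.gcd M (R - 1) : ℕ) : ℤ)) := by
  have h : (PresentedGroup.mk (beylRels M N R l) (FreeGroup.of 1 ^ N *
      (FreeGroup.of 0 ^ (l * ((M / Int.gcd M (R - 1) : ℕ) : ℤ)))⁻¹)) = 1 :=
    PresentedGroup.one_of_mem (Or.inr (Or.inr rfl))
  rw [map_mul, map_inv, mul_inv_eq_one, map_zpow, map_pow] at h
  exact h

variable (M N R l) in
/-- The cyclic subgroup generated by `a`. -/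
def beylKernel : Subgroup (BeylGroup M N R l) := Subgroup.zpowers (PresentedGroup.of 0)

theorem finite_beylKernel (hM : 0 < M) : Finite (beylKernel M N R l) := by
  exact finite_zpowers.mpr (isOfFinOrder_iff_pow_eq_one.mpr ⟨M, hM, beyl_pow_eq_one⟩)

/-- Conjugation by b maps ⟨a⟩ into itself, and finiteness of ⟨a⟩ turns this inclusion into an
equality. -/
theorem beylKernel_normal (hM : 0 < M) : (beylKernel M N R l).Normal := by
  have := finite_beylKernel (N := N) (R := R) (l := l) hM
  rw [← Subgroup.normalizer_eq_top_iff, eq_top_iff, ← PresentedGroup.closure_range_of,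
    Subgroup.closure_le]
  rintro _ ⟨i, rfl⟩
  fin_cases i
  · exact Subgroup.le_normalizer (Subgroup.mem_zpowers _)
  · refine Subgroup.mem_normalizer_fintype ?_
    rintro _ ⟨z, rfl⟩
    change PresentedGroup.of 1 * PresentedGroup.of 0 ^ z * (PresentedGroup.of 1)⁻¹ ∈
      beylKernel M N R l
    rw [← conj_zpow, beyl_conj, ← zpow_mul]
    exact ⟨_, rfl⟩

theorem beyl_quotient_eq_zpow (hK : (beylKernel M N R l).Normal)
    (q : BeylGroup M N R l ⧸ beylKernel M N R l) :
    q ∈ Subgroup.zpowers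
      ((PresentedGroup.of 1 : BeylGroup M N R l) : BeylGroup M N R l ⧸ beylKernel M N R l) := by
  obtain ⟨g, rfl⟩ := QuotientGroup.mk'_surjective _ q
  have h : (⊤ : Subgroup (BeylGroup M N R l)) ≤ (Subgroup.zpowers ((PresentedGroup.of 1 :
      BeylGroup M N R l) : BeylGroup M N R l ⧸ beylKernel M N R l)).comap
        (QuotientGroup.mk' _) := by
    rw [← PresentedGroup.closure_range_of, Subgroup.closure_le]
    rintro _ ⟨i, rfl⟩
    fin_cases i
    · have h0 : ((PresentedGroup.of 0 : BeylGroup M N R l) :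
          BeylGroup M N R l ⧸ beylKernel M N R l) = 1 :=
        (QuotientGroup.eq_one_iff _).mpr (Subgroup.mem_zpowers _)
      change ((PresentedGroup.of 0 : BeylGroup M N R l) :
          BeylGroup M N R l ⧸ beylKernel M N R l) ∈ Subgroup.zpowers _
      rw [h0]
      exact Subgroup.one_mem _
    · exact Subgroup.mem_zpowers _
  exact h (Subgroup.mem_top g)

theorem isMetacyclic_beylGroup (hM : 0 < M) : IsMetacyclic (BeylGroup M N R l) :=
  ⟨beylKernel M N R l, beylKernel_normal hM, inferInstanceAs (IsCyclic (Subgroup.zpowers _)),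
    haveI := beylKernel_normal (N := N) (R := R) (l := l) hM
    ⟨_, beyl_quotient_eq_zpow inferInstance⟩⟩

theorem beyl_quotient_pow_eq_one (hK : (beylKernel M N R l).Normal) :
    ((PresentedGroup.of 1 : BeylGroup M N R l) :
      BeylGroup M N R l ⧸ beylKernel M N R l) ^ N = 1 := by
  rw [← QuotientGroup.mk_pow, QuotientGroup.eq_one_iff, beyl_pow_eq]
  exact ⟨_, rfl⟩

theorem card_beyl_quotient_dvd (hM : 0 < M) :
    Nat.card (BeylGroup M N R l ⧸ beylKernel M N R l) ∣ N := by
  have hK := beylKernel_normal (N := N) (R := R) (l := l) hM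
  rw [← orderOf_eq_card_of_forall_mem_zpowers (beyl_quotient_eq_zpow hK)]
  exact orderOf_dvd_of_pow_eq_one (beyl_quotient_pow_eq_one hK)

theorem finite_beylGroup (hM : 0 < M) (hN : 0 < N) : Finite (BeylGroup M N R l) := by
  have h1 := card_beyl_quotient_dvd (N := N) (R := R) (l := l) hM
  have : Finite (beylKernel M N R l) := finite_beylKernel hM
  have : Finite (BeylGroup M N R l ⧸ beylKernel M N R l) :=
    Nat.finite_of_card_ne_zero (Nat.pos_of_dvd_of_pos h1 hN).ne'
  exact Finite.of_subgroup_quotient (beylKernel M N R l)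

theorem card_beylGroup_le (hM : 0 < M) (hN : 0 < N) : Nat.card (BeylGroup M N R l) ≤ M * N := by
  rw [Subgroup.card_eq_card_quotient_mul_card_subgroup (beylKernel M N R l), mul_comm]
  refine Nat.mul_le_mul (Nat.le_of_dvd hM ?_)
    (Nat.le_of_dvd hN (card_beyl_quotient_dvd hM))
  rw [beylKernel, Nat.card_zpowers]
  exact orderOf_dvd_of_pow_eq_one beyl_pow_eq_one

theorem isCyclic_beylGroup_one (hM : 0 < M) : IsCyclic (BeylGroup M 1 R l) := by
  have h := Nat.dvd_one.mp (card_beyl_quotient_dvd (N := 1) (R := R) (l := l) hM)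
  have h2 : beylKernel M 1 R l = ⊤ := Subgroup.index_eq_one.mp h
  refine ⟨PresentedGroup.of 0, fun g => ?_⟩
  change g ∈ beylKernel M 1 R l
  rw [h2]
  exact Subgroup.mem_top g

/-- A homomorphism from `BeylGroup M N R l` given by elements satisfying its relations. -/
theorem exists_beyl_hom {X : Type*} [Group X] (a b : X) (ha : a ^ M = 1)
    (hab : b * a * b⁻¹ = a ^ R)
    (hb : b ^ N = a ^ (l * ((M / Int.gcd M (R - 1) : ℕ) : ℤ))) :
    ∃ F : BeylGroup M N R l →* X, F (PresentedGroup.of 0) = a ∧ F (PresentedGroup.of 1) = b := by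
  have h : ∀ u ∈ beylRels M N R l, FreeGroup.lift ![a, b] u = 1 := by
    rintro _ (rfl | rfl | rfl)
    · simpa using ha
    · simp [hab]
    · rw [map_mul, map_inv, mul_inv_eq_one, map_zpow, map_pow]
      simpa using hb
  exact ⟨PresentedGroup.toGroup h, PresentedGroup.toGroup.of h, PresentedGroup.toGroup.of h⟩

end Beyl

/-! ### Arithmetic of the norm 1 + R + ⋯ + R^(N-1). -/

section Arithmetic

theorem pow_eq_pow_of_natModEq {A : Type*} [Monoid A] {T : A} {N : ℕ} (hT : T ^ N = 1) {a b : ℕ}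
    (h : a ≡ b [MOD N]) : T ^ a = T ^ b := by
  rw [pow_eq_pow_mod a hT, pow_eq_pow_mod b hT, h]

/-- Multiplication by j permutes the residues modulo N. -/
theorem sum_range_pow_pow_of_coprime {A : Type*} [CommSemiring A] {T : A} {N j : ℕ}
    (hT : T ^ N = 1) (hN : 0 < N) (hj : Nat.Coprime j N) :
    ∑ t ∈ Finset.range N, (T ^ j) ^ t = ∑ t ∈ Finset.range N, T ^ t := by
  have hmap : Set.MapsTo (fun t => j * t % N) (Finset.range N) (Finset.range N) :=
    fun t _ => by simpa using Nat.mod_lt _ hN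
  have hinj : Set.InjOn (fun t => j * t % N) (Finset.range N) := by
    intro a ha b hb hab
    have h : a ≡ b [MOD N] :=
      Nat.ModEq.cancel_left_of_coprime (c := j) (by rwa [Nat.gcd_comm]) hab
    rw [Finset.mem_coe, Finset.mem_range] at ha hb
    exact Nat.ModEq.eq_of_lt_of_lt h ha hb
  refine Finset.sum_nbij (fun t => j * t % N) hmap hinj
    (Finset.surjOn_of_injOn_of_card_le _ hmap hinj le_rfl) fun t _ => ?_
  rw [← pow_mul]
  exact pow_eq_pow_of_natModEq hT (Nat.mod_modEq _ _).symm

theorem exists_mul_modEq_one {j N : ℕ} (hj : Nat.Coprime j N) (hN : 0 < N) :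
    ∃ j', j * j' ≡ 1 [MOD N] := by
  have : NeZero N := ⟨hN.ne'⟩
  refine ⟨((j : ZMod N)⁻¹).val, ?_⟩
  rw [← ZMod.natCast_eq_natCast_iff]
  push_cast
  rw [ZMod.natCast_zmod_val, ZMod.coe_mul_inv_eq_one j hj]

theorem intGcd_congr {M x y : ℤ} (h : ∀ D : ℤ, D ∣ M → (D ∣ x ↔ D ∣ y)) :
    Int.gcd M x = Int.gcd M y := by
  apply Nat.dvd_antisymm
  · refine Int.natCast_dvd_natCast.mp (Int.dvd_coe_gcd (Int.gcd_dvd_left ..) ?_)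
    exact (h _ (Int.gcd_dvd_left ..)).mp (Int.gcd_dvd_right ..)
  · refine Int.natCast_dvd_natCast.mp (Int.dvd_coe_gcd (Int.gcd_dvd_left ..) ?_)
    exact (h _ (Int.gcd_dvd_left ..)).mpr (Int.gcd_dvd_right ..)

/-- In a ring where `ρ` has the inverse `σ`, a geometric sum in `ς σ` is a homogeneous one. -/
theorem sum_mul_pow_eq {A : Type*} [CommRing A] {ρ σ ς : A} (h : ρ * σ = 1) (N : ℕ) :
    ∑ t ∈ Finset.range N, (ς * σ) ^ t =
      σ ^ (N - 1) * ∑ t ∈ Finset.range N, ς ^ t * ρ ^ (N - 1 - t) := by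
  rw [Finset.mul_sum]
  refine Finset.sum_congr rfl fun t ht => ?_
  rw [Finset.mem_range] at ht
  obtain ⟨q, hq⟩ : ∃ q, N - 1 = q + t := ⟨N - 1 - t, by omega⟩
  rw [hq, Nat.add_sub_cancel, mul_pow, pow_add]
  have : σ ^ q * ρ ^ q = 1 := by rw [← mul_pow, mul_comm σ, h, one_pow]
  linear_combination (-(ς ^ t * σ ^ t)) * this

/-- If `kN` divides `ρ - ς` with `ρ, ς` coprime, the cofactor of `ρ - ς` in `ρ ^ N - ς ^ N`
is `N` times a number prime to `k`. -/
theorem exists_geomSum_eq_mul {ρ ς : ℤ} (hco : IsCoprime ρ ς) {k N : ℕ} (hN : 0 < N)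
    (hk : (k * N : ℤ) ∣ ρ - ς) :
    ∃ Q : ℤ, ∑ t ∈ Finset.range N, ς ^ t * ρ ^ (N - 1 - t) = N * Q ∧ IsCoprime Q k := by
  -- Modulo kN one may replace ς by ρ, and all N summands become ρ^(N-1).
  have h1 : (k * N : ℤ) ∣ ∑ t ∈ Finset.range N, ς ^ t * ρ ^ (N - 1 - t) - N * ρ ^ (N - 1) := by
    have h2 : (N : ℤ) * ρ ^ (N - 1) = ∑ t ∈ Finset.range N, ρ ^ t * ρ ^ (N - 1 - t) := by
      rw [Finset.sum_congr rfl (g := fun _ => ρ ^ (N - 1))]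
      · simp
      · intro t ht
        rw [Finset.mem_range] at ht
        rw [← pow_add]
        congr 1
        omega
    rw [h2, ← Finset.sum_sub_distrib]
    refine Finset.dvd_sum fun t _ => ?_
    rw [← sub_mul]
    refine Dvd.dvd.mul_right (hk.trans ?_) _
    exact (dvd_sub_comm.mp (sub_dvd_pow_sub_pow ρ ς t))
  obtain ⟨c, hc⟩ := h1
  refine ⟨ρ ^ (N - 1) + k * c, by linear_combination hc, ?_⟩
  -- ρ is prime to ρ - ς, of which k is a divisor.
  have h3 : IsCoprime ρ (k : ℤ) := by
    have h4 : IsCoprime ρ (ρ - ς) := by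
      obtain ⟨a, b, hab⟩ := hco
      exact ⟨a + b, -b, by linear_combination hab⟩
    exact h4.of_isCoprime_of_dvd_right ((Dvd.intro _ rfl).trans hk)
  exact IsCoprime.add_mul_left_left h3.pow_left c

theorem intCast_eq_of_dvd {m : ℤ} {μ : ℕ} {a b : ℤ} (hm : m ∣ μ)
    (h : (a : ZMod μ) = b) : m ∣ a - b := by
  rw [ZMod.intCast_eq_intCast_iff] at h
  exact hm.trans ((dvd_sub_comm).mp h.dvd)

/-- The norm `1 + R + ⋯ + R ^ (N - 1)` is `N M / (M, R - 1)` up to a unit modulo `M`. -/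
theorem exists_norm_modEq {r s rhat : ℤ} {k d N M j : ℕ} (hrs : IsCoprime r s)
    (hk : (k * N : ℤ) ∣ r - s) (hk0 : 0 < k) (hM : 0 < M) (hN : 0 < N)
    (hμ : k * N * M = (r ^ (d * N) - s ^ (d * N)).natAbs)
    (hrhat : r * rhat ≡ 1 [ZMOD (k * N * M : ℕ)]) (hj : Nat.Coprime j N) :
    ∃ c : ℤ, IsCoprime c M ∧
      ∑ t ∈ Finset.range N, ((s * rhat) ^ (d * j)) ^ t ≡
        N * (c * ((M / Int.gcd M ((s * rhat) ^ (d * j) - 1) : ℕ) : ℤ)) [ZMOD (N * M : ℕ)] := by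
  set μ : ℕ := k * N * M with hμdef
  set ρ := r ^ d with hρ
  set ς := s ^ d with hς
  have hco : IsCoprime ρ ς := hrs.pow
  have hk' : (k * N : ℤ) ∣ ρ - ς := hk.trans (sub_dvd_pow_sub_pow _ _ _)
  obtain ⟨Q, hQ, hQk⟩ := exists_geomSum_eq_mul hco hN hk'
  obtain ⟨e, he⟩ := hk'
  have hgeom : (N * Q) * (ρ - ς) = ρ ^ N - ς ^ N := by
    rw [← hQ, ← neg_sub ς, mul_neg, geom_sum₂_mul]
    ring
  have hμ' : (μ : ℤ) = |(N * Q) * (ρ - ς)| := by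
    rw [hgeom, hρ, hς, ← pow_mul, ← pow_mul, hμ, Int.natCast_natAbs]
  have hMQ : (M : ℤ) = |e * N * Q| := by
    have h0 : (0 : ℤ) < k * N := by positivity
    have h1 : (k * N : ℤ) * M = (k * N) * |e * N * Q| := by
      rw [← abs_of_pos h0, ← abs_mul, abs_of_pos h0]
      rw [show (k * N : ℤ) * (e * N * Q) = N * Q * (ρ - ς) by rw [he]; ring, ← hμ', hμdef]
      push_cast
      ring
    exact mul_left_cancel₀ h0.ne' h1
  have hρq : (ρ : ZMod μ) * ((rhat ^ d : ℤ) : ZMod μ) = 1 := by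
    have := (ZMod.intCast_eq_intCast_iff _ _ _).mpr hrhat
    rw [← Int.cast_mul, hρ, ← mul_pow, Int.cast_pow, this]
    simp
  have hρς : (ρ : ZMod μ) ^ N = (ς : ZMod μ) ^ N := by
    have h1 : ((ρ ^ N - ς ^ N : ℤ) : ZMod μ) = 0 := by
      rw [ZMod.intCast_zmod_eq_zero_iff_dvd, ← hgeom, hμ']
      exact (abs_dvd _ _).mpr dvd_rfl
    push_cast at h1
    exact sub_eq_zero.mp h1
  set T : ℤ := (s * rhat) ^ d with hT
  have hTς : (T : ZMod μ) = (ς : ZMod μ) * ((rhat ^ d : ℤ) : ZMod μ) := by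
    rw [← Int.cast_mul, hT, mul_pow]
  have hTN : (T : ZMod μ) ^ N = 1 := by
    rw [hTς, mul_pow, ← hρς, ← mul_pow, hρq, one_pow]
  have hMμ : (M : ℤ) ∣ μ := Int.natCast_dvd_natCast.mpr (Dvd.intro_left _ rfl)
  -- For a divisor D of M, dividing T^j - 1, T - 1 or ρ - ς is the same: T is a power of T^j, and ρT
  -- ≡ ς with ρ a unit modulo D. Then ρ - ς = eNk and M = |eNQ| with Q prime to k leave |eN|.
  have hgcd : Int.gcd M ((s * rhat) ^ (d * j) - 1) = (e * N).natAbs := by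
    have h1 : Int.gcd M ((s * rhat) ^ (d * j) - 1) = Int.gcd M (ρ - ς) := by
      refine intGcd_congr fun D hD => ?_
      have hDμ : D ∣ μ := hD.trans hMμ
      have hDT : D ∣ ρ * T - ς := by
        refine intCast_eq_of_dvd hDμ ?_
        push_cast
        rw [hTς]
        linear_combination (ς : ZMod μ) * hρq
      have hDρ : IsCoprime D ρ := by
        have h2 := intCast_eq_of_dvd (a := ρ * rhat ^ d) (b := 1) hDμ
          (by rw [Int.cast_mul, hρq, Int.cast_one])
        obtain ⟨x, hx⟩ := h2
        exact ⟨-x, rhat ^ d, by linear_combination hx⟩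
      have hiff : D ∣ T - 1 ↔ D ∣ ρ - ς := by
        rw [show ρ - ς = (ρ * T - ς) - ρ * (T - 1) by ring, dvd_sub_right hDT]
        exact ⟨fun h => h.mul_left _, fun h => hDρ.dvd_of_dvd_mul_left h⟩
      rw [← hiff, pow_mul, ← hT]
      constructor
      · intro h
        obtain ⟨j', hj'⟩ := exists_mul_modEq_one hj hN
        have h3 : D ∣ (T ^ j) ^ j' - T := by
          refine intCast_eq_of_dvd hDμ ?_
          push_cast
          rw [← pow_mul, pow_eq_pow_of_natModEq hTN hj', pow_one]
        have h4 : D ∣ (T ^ j) ^ j' - 1 := h.trans (sub_one_dvd_pow_sub_one _ _)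
        have h5 := dvd_sub h4 h3
        rwa [sub_sub_sub_cancel_left] at h5
      · exact fun h => h.trans (sub_one_dvd_pow_sub_one _ _)
    rw [h1, he, hMQ, Int.gcd_eq_natAbs, Int.natAbs_abs, ← Int.gcd_eq_natAbs, show (k * N : ℤ) * e = e * N * k by ring,
      Int.gcd_mul_left, Int.isCoprime_iff_gcd_eq_one.mp hQk, mul_one]
  have hdiv : ((M / Int.gcd M ((s * rhat) ^ (d * j) - 1) : ℕ) : ℤ) = |Q| := by
    have h1 : M = (e * N).natAbs * Q.natAbs := by
      zify
      rw [hMQ, abs_mul]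
    rw [hgcd, h1, Nat.mul_div_cancel_left _ (Nat.pos_of_mul_pos_right (h1 ▸ hM)),
      Int.natCast_natAbs]
  have hsum : ((∑ t ∈ Finset.range N, ((s * rhat) ^ (d * j)) ^ t : ℤ) : ZMod μ) =
      (((rhat ^ d) ^ (N - 1) * (N * Q) : ℤ) : ZMod μ) := by
    have h1 := sum_range_pow_pow_of_coprime hTN hN hj
    have h2 := sum_mul_pow_eq (ς := (ς : ZMod μ)) hρq N
    rw [← hTς] at h2
    rw [pow_mul, ← hT, ← hQ]
    push_cast at h1 h2 ⊢
    rw [h1, h2]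
  have hcop : IsCoprime ((rhat ^ d) ^ (N - 1)) (M : ℤ) := by
    obtain ⟨x, hx⟩ := intCast_eq_of_dvd (a := ρ * rhat ^ d) (b := 1) hMμ
      (by rw [Int.cast_mul, hρq, Int.cast_one])
    exact IsCoprime.pow_left ⟨ρ, -x, by linear_combination hx⟩
  have hfin : ((N * M : ℕ) : ℤ) ∣ ∑ t ∈ Finset.range N, ((s * rhat) ^ (d * j)) ^ t -
      (rhat ^ d) ^ (N - 1) * (N * Q) :=
    intCast_eq_of_dvd (Int.natCast_dvd_natCast.mpr ⟨k, by rw [hμdef]; ring⟩) hsum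
  rw [hdiv]
  -- M/(M,R-1) is |Q|, so the sign of Q goes into the unit c.
  rcases abs_choice Q with h | h
  · refine ⟨_, hcop, Int.ModEq.symm (Int.modEq_iff_dvd.mpr ?_)⟩
    rw [h]
    convert hfin using 2
    ring
  · refine ⟨_, hcop.neg_left, Int.ModEq.symm (Int.modEq_iff_dvd.mpr ?_)⟩
    rw [h]
    convert hfin using 2
    ring

end Arithmetic

/-! ### The kernel of ν as a group B(M,N,R,1). -/

section Kernel

theorem mul_zpow_pow {X : Type*} [Group X] {y v : X} {R : ℤ} {i : ℕ}
    (h : ∀ z : ℤ, v ^ i * y ^ z * (v ^ i)⁻¹ = y ^ (R * z)) (k : ℤ) (t : ℕ) :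
    (y ^ k * v ^ i) ^ t = y ^ (k * ∑ j ∈ Finset.range t, R ^ j) * v ^ (i * t) := by
  induction t with
  | zero => simp
  | succ t ih =>
    have h1 := h (k * ∑ j ∈ Finset.range t, R ^ j)
    rw [mul_inv_eq_iff_eq_mul] at h1
    rw [pow_succ', ih, mul_assoc, ← mul_assoc (v ^ i), h1, geom_sum_succ, ← mul_assoc, ← mul_assoc,
      ← zpow_add, mul_assoc, ← pow_add]
    congr 2
    · ring
    · ring

/-- The kernel of the map of the split metacyclic group to `ZMod n` is a group `B(M, N, R, 1)`. -/
theorem nonempty_beylGroup_mulEquiv_ker {r s rhat f' α : ℤ} {g k d N M j : ℕ}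
    (hg0 : 0 < g) (hk0 : 0 < k) (hd0 : 0 < d) (hN : 0 < N) (hM : 0 < M)
    (hrs : IsCoprime r s) (hk : (k * N : ℤ) ∣ r - s)
    (hμ : k * N * M = (r ^ (d * N) - s ^ (d * N)).natAbs)
    (hrhat : r * rhat ≡ 1 [ZMOD (k * N * M : ℕ)])
    (hf' : IsCoprime f' (k * N : ℤ)) (hα : IsCoprime α (d : ℤ)) (hkd : IsCoprime (k : ℤ) d)
    (hj : Nat.Coprime j N) (hjα : j * α ≡ f' [ZMOD N])
    (S : (ZMod (k * N * M))ˣ) (hS : S ^ (d * N) = 1)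
    (hST : (S : ZMod (k * N * M)) = ((s * rhat : ℤ) : ZMod (k * N * M)))
    (ν : SplitMetacyclic (k * N * M) (d * N) S hS →* Multiplicative (ZMod (g * k * d * N)))
    (hνy : ν (SplitMetacyclic.genY _ _ S hS) =
      Multiplicative.ofAdd ((g * d * f' : ℤ) : ZMod (g * k * d * N)))
    (hνv : ν (SplitMetacyclic.genV _ _ S hS) =
      Multiplicative.ofAdd ((-(g * k * α) : ℤ) : ZMod (g * k * d * N)))
    (hcard : g * Nat.card ν.range = g * k * d * N)
    {R : ℤ} (hR : R ≡ (s * rhat) ^ (d * j) [ZMOD M]) :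
    Nonempty (BeylGroup M N R 1 ≃* ν.ker) ∧ Nat.card (BeylGroup M N R 1) = M * N := by
  set y := SplitMetacyclic.genY _ _ S hS with hy_def
  set v := SplitMetacyclic.genV _ _ S hS with hv_def
  set R₀ : ℤ := (s * rhat) ^ (d * j) with hR₀
  obtain ⟨c, hcM, hc⟩ := exists_norm_modEq (d := d) hrs hk hk0 hM hN hμ hrhat hj
  have hyμ : y ^ (k * N * M) = 1 := SplitMetacyclic.genY_pow_card _ _ S hS
  have hvp : v ^ (d * N) = 1 := SplitMetacyclic.genV_pow_card _ _ S hS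
  have hconj : ∀ z : ℤ, v ^ (d * j) * y ^ z * (v ^ (d * j))⁻¹ = y ^ (R₀ * z) :=
    conj_pow_zpow (SplitMetacyclic.genV_conj_genY _ _ S hS hST) (d * j)
  have hgcd : Int.gcd M (R - 1) = Int.gcd M (R₀ - 1) := by
    refine intGcd_congr fun D hD => ?_
    have h := hD.trans hR.dvd
    rw [show R₀ - 1 = (R₀ - R) + (R - 1) by ring, dvd_add_right h]
  have hνz : ∀ z x : ℤ, ν (y ^ z * v ^ x) = 1 ↔ (k * d * N : ℤ) ∣ z * (d * f') - x * (k * α) := by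
    intro z x
    have e : ((g * k * d * N : ℕ) : ℤ) = g * (k * d * N) := by push_cast; ring
    rw [map_mul, map_zpow, map_zpow, hνy, hνv, ← ofAdd_zsmul, ← ofAdd_zsmul, ← ofAdd_add,
      ← ofAdd_zero, Multiplicative.ofAdd.injective.eq_iff, zsmul_eq_mul, zsmul_eq_mul,
      ← Int.cast_mul, ← Int.cast_mul, ← Int.cast_add, ZMod.intCast_zmod_eq_zero_iff_dvd, e,
      show z * (g * d * f') + x * -(g * k * α) = g * (z * (d * f') - x * (k * α)) by ring,
      mul_dvd_mul_iff_left (by positivity)]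
  have hνy' : ∀ z : ℤ, ν (y ^ z) = 1 ↔ (k * N : ℤ) ∣ z := by
    intro z
    have h := hνz z 0
    rw [zpow_zero, mul_one] at h
    rw [h, show z * (d * f') - 0 * (k * α) = d * (z * f') by ring,
      show (k * d * N : ℤ) = d * (k * N) by ring, mul_dvd_mul_iff_left (by positivity)]
    exact ⟨fun h => hf'.symm.dvd_of_dvd_mul_right h, fun h => h.mul_right _⟩
  -- y^(kN) generates the part of the kernel inside ⟨y⟩; the unit c makes b^N the required power of
  -- a exactly. In b, the congruence jα ≡ f' modulo N puts y^k v^(dj) in the kernel.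
  let a : ν.ker := ⟨y ^ (k * N * c : ℤ), (hνy' _).mpr (Dvd.intro _ rfl)⟩
  let b : ν.ker := ⟨y ^ (k : ℤ) * v ^ (d * j), by
    rw [MonoidHom.mem_ker, ← zpow_natCast v, hνz]
    obtain ⟨w, hw⟩ := hjα.dvd
    refine ⟨w, ?_⟩
    push_cast
    linear_combination (k * d : ℤ) * hw⟩
  have ha : a ^ M = 1 := by
    apply Subtype.ext
    change (y ^ (k * N * c : ℤ)) ^ M = 1
    rw [← zpow_natCast, ← zpow_mul, show (k * N * c * M : ℤ) = ((k * N * M : ℕ) : ℤ) * c by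
      push_cast; ring, zpow_mul, zpow_natCast, hyμ, one_zpow]
  have hab : b * a * b⁻¹ = a ^ R := by
    rw [zpow_eq_zpow_of_modEq ha hR]
    apply Subtype.ext
    change y ^ (k : ℤ) * v ^ (d * j) * y ^ (k * N * c : ℤ) * (y ^ (k : ℤ) * v ^ (d * j))⁻¹ =
      (y ^ (k * N * c : ℤ)) ^ R₀
    have h := hconj (k * N * c)
    rw [mul_inv_eq_iff_eq_mul] at h
    rw [mul_assoc (y ^ (k : ℤ)), h, ← zpow_mul, mul_inv_eq_iff_eq_mul, ← mul_assoc (y ^ (k : ℤ)),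
      ← mul_assoc (y ^ (k * N * c * R₀ : ℤ)), ← zpow_add, ← zpow_add]
    congr 2
    ring
  have hb : b ^ N = a ^ (1 * ((M / Int.gcd M (R - 1) : ℕ) : ℤ)) := by
    apply Subtype.ext
    change (y ^ (k : ℤ) * v ^ (d * j)) ^ N = (y ^ (k * N * c : ℤ)) ^ _
    rw [mul_zpow_pow hconj, show d * j * N = d * N * j by ring, pow_mul v, hvp, one_pow, mul_one,
      hgcd, ← zpow_mul, one_mul]
    apply zpow_eq_zpow_of_modEq hyμ
    have h := hc.mul_left' (c := (k : ℤ))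
    convert h using 1
    · push_cast; ring
    · ring
  obtain ⟨F, hFa, hFb⟩ := exists_beyl_hom (l := 1) a b ha hab hb
  have hsurj : Function.Surjective F := by
    rintro ⟨h, hh⟩
    obtain ⟨z, x, rfl⟩ := SplitMetacyclic.exists_eq_zpow_mul_zpow _ _ S hS h
    -- On the kernel d divides the exponent of v, so a power of b removes the v-part and leaves a
    -- power of y^(kN), hence of a.
    have hdx : (d : ℤ) ∣ x := by
      obtain ⟨w, hw⟩ := (hνz z x).mp hh
      have h1 : (d : ℤ) ∣ x * (k * α) := ⟨z * f' - k * N * w, by linear_combination -hw⟩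
      exact (IsCoprime.mul_right hkd.symm hα.symm).dvd_of_dvd_mul_right h1
    obtain ⟨x', rfl⟩ := hdx
    obtain ⟨j', hj'⟩ := exists_mul_modEq_one hj hN
    obtain ⟨x₀, hx₀⟩ : ∃ x₀ : ℕ, (x₀ : ℤ) ≡ x' [ZMOD N] :=
      ⟨(x' % N).toNat, by
        rw [Int.toNat_of_nonneg (Int.emod_nonneg _ (by positivity))]
        exact Int.mod_modEq _ _⟩
    set t := j' * x₀ with ht
    have h2 : v ^ (d * x') = v ^ (d * j * t) := by
      rw [← zpow_natCast]
      apply zpow_eq_zpow_of_modEq hvp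
      have h3 : (j * j' : ℤ) ≡ 1 [ZMOD N] := by exact_mod_cast Int.natCast_modEq_iff.mpr hj'
      have h4 := (h3.mul hx₀).mul_left' (c := (d : ℤ))
      rw [one_mul] at h4
      push_cast
      refine Int.ModEq.trans h4.symm ?_
      rw [ht]
      push_cast
      exact congrArg (fun q : ℤ => q % (d * N)) (by ring)
    set w : ℤ := z - k * ∑ i ∈ Finset.range t, R₀ ^ i with hw
    have h5 : y ^ z * v ^ (d * x') = y ^ w * (b : SplitMetacyclic _ _ S hS) ^ t := by
      change _ = y ^ w * (y ^ (k : ℤ) * v ^ (d * j)) ^ t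
      rw [mul_zpow_pow hconj, ← mul_assoc, ← zpow_add, h2, hw, sub_add_cancel]
    have h6 : ν (y ^ w) = 1 := by
      have h7 : ν (y ^ z * v ^ (d * x')) = 1 := hh
      have h8 : ν (b : SplitMetacyclic _ _ S hS) = 1 := b.2
      rw [h5, map_mul, map_pow, h8, one_pow, mul_one] at h7
      exact h7
    obtain ⟨w', hw'⟩ := (hνy' w).mp h6
    obtain ⟨c', c'', hcc⟩ := hcM
    refine ⟨PresentedGroup.of 0 ^ (c' * w') * PresentedGroup.of 1 ^ t, ?_⟩
    rw [map_mul, map_zpow, map_pow, hFa, hFb]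
    apply Subtype.ext
    change (y ^ (k * N * c : ℤ)) ^ (c' * w') * (b : SplitMetacyclic _ _ S hS) ^ t =
      y ^ z * v ^ (d * x')
    rw [h5, ← zpow_mul]
    congr 1
    apply zpow_eq_zpow_of_modEq hyμ
    refine Int.modEq_iff_dvd.mpr ⟨c'' * w', ?_⟩
    rw [hw']
    push_cast
    linear_combination (-(k * N * w' : ℤ)) * hcc
  -- |H| = (kNM)(dN) and the image of ν has kdN elements. With the bound MN on the other side,
  -- surjectivity gives bijectivity.
  have hker : Nat.card ν.ker = M * N := by
    have h1 := Subgroup.card_mul_index ν.ker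
    rw [Subgroup.index_ker, SplitMetacyclic.card_eq] at h1
    have h2 : Nat.card ν.range = k * d * N :=
      Nat.eq_of_mul_eq_mul_left hg0 (by rw [hcard]; ring)
    rw [h2] at h1
    exact Nat.eq_of_mul_eq_mul_right (by positivity : 0 < k * d * N) (by rw [h1]; ring)
  have hfin : Finite (BeylGroup M N R 1) := finite_beylGroup hM hN
  have hbij : Function.Bijective F := hsurj.bijective_of_nat_card_le
    (by rw [hker]; exact card_beylGroup_le hM hN)
  exact ⟨⟨MulEquiv.ofBijective F hbij⟩, by rw [Nat.card_congr (Equiv.ofBijective F hbij), hker]⟩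

end Kernel

/-! ### Quotients of ℤ/n, reindexed free products and modular powers. -/

section Index

theorem card_quotient_eq {n g : ℕ} (hgn : g ∣ n) (D : Subgroup (Multiplicative (ZMod n)))
    (hD : ∀ x : ℤ, Multiplicative.ofAdd (x : ZMod n) ∈ D ↔ (g : ℤ) ∣ x) :
    Nat.card (Multiplicative (ZMod n) ⧸ D) = g := by
  let q : Multiplicative (ZMod n) →* Multiplicative (ZMod g) :=
    AddMonoidHom.toMultiplicative (ZMod.castHom hgn (ZMod g)).toAddMonoidHom
  have hq : ∀ x : ℤ, q (Multiplicative.ofAdd (x : ZMod n)) =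
      Multiplicative.ofAdd (x : ZMod g) := by
    intro x
    change Multiplicative.ofAdd (ZMod.castHom hgn (ZMod g) (x : ZMod n)) = _
    rw [map_intCast]
  have hker : D = q.ker := by
    ext w
    obtain ⟨x, hx⟩ := ZMod.intCast_surjective (Multiplicative.toAdd w)
    obtain rfl : Multiplicative.ofAdd (x : ZMod n) = w := hx
    rw [hD, MonoidHom.mem_ker, hq, ← ofAdd_zero, Multiplicative.ofAdd.injective.eq_iff,
      ZMod.intCast_zmod_eq_zero_iff_dvd]
  have hsurj : Function.Surjective q := by
    intro w
    obtain ⟨x, hx⟩ := ZMod.intCast_surjective (Multiplicative.toAdd w)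
    exact ⟨Multiplicative.ofAdd (x : ZMod n), (hq x).trans (congrArg Multiplicative.ofAdd hx)⟩
  subst hker
  rw [Nat.card_congr (QuotientGroup.quotientKerEquivOfSurjective q hsurj).toEquiv]
  exact Nat.card_zmod g

/-- Free products of copies of isomorphic groups over equivalent index types are isomorphic. -/
def coprodICongr {I J G G' : Type*} [Group G] [Group G'] (e : I ≃ J) (F : G ≃* G') :
    Monoid.CoprodI (fun _ : I => G) ≃* Monoid.CoprodI (fun _ : J => G') :=
  MonoidHom.toMulEquiv
    (Monoid.CoprodI.lift fun i =>
      (Monoid.CoprodI.of (M := fun _ : J => G') (i := e i)).comp F.toMonoidHom)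
    (Monoid.CoprodI.lift fun j =>
      (Monoid.CoprodI.of (M := fun _ : I => G) (i := e.symm j)).comp F.symm.toMonoidHom)
    (by
      apply Monoid.CoprodI.ext_hom
      intro i
      ext a
      simp)
    (by
      apply Monoid.CoprodI.ext_hom
      intro j
      ext a
      simp)

theorem powMod_modEq {M P : ℕ} {b : ℤ} (hP : 0 < P) (hb : b ^ P ≡ 1 [ZMOD M]) {i : ℤ} {t : ℕ}
    (h : (t : ℤ) ≡ i [ZMOD P]) : powMod M b i ≡ b ^ t [ZMOD M] := by
  have hb' : (b : ZMod M) ^ P = 1 := by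
    have := (ZMod.intCast_eq_intCast_iff _ _ _).mpr hb
    simpa using this
  rw [← ZMod.intCast_eq_intCast_iff]
  rcases i with k | k
  · have h1 : t ≡ k [MOD P] := Int.natCast_modEq_iff.mp h
    simp only [powMod, Int.cast_pow]
    exact (pow_eq_pow_of_natModEq hb' h1).symm
  · have hco : Int.gcd b M = 1 := by
      rw [← Int.isCoprime_iff_gcd_eq_one]
      obtain ⟨w, hw⟩ := hb.dvd
      obtain ⟨P', rfl⟩ : ∃ P', P = P' + 1 := ⟨P - 1, by omega⟩
      exact ⟨b ^ P', w, by rw [← pow_succ]; linear_combination -hw⟩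
    have hinv : (b : ZMod M) * (Int.gcdA b M : ZMod M) = 1 := by
      have h1 := congrArg (Int.cast : ℤ → ZMod M) (Int.gcd_eq_gcd_ab b M)
      rw [hco] at h1
      push_cast at h1
      simpa using h1.symm
    -- The negative exponent is -(k+1), so b^t is an inverse of b^(k+1).
    have hdvd : P ∣ t + (k + 1) := by
      have h2 := h.symm.dvd
      rw [Int.negSucc_eq, sub_neg_eq_add] at h2
      exact_mod_cast h2
    have h3 : (b : ZMod M) ^ (t + (k + 1)) = 1 := by
      obtain ⟨w, hw⟩ := hdvd
      rw [hw, pow_mul, hb', one_pow]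
    simp only [powMod, Int.cast_pow]
    calc (Int.gcdA b M : ZMod M) ^ (k + 1)
        = (b : ZMod M) ^ (t + (k + 1)) * (Int.gcdA b M : ZMod M) ^ (k + 1) := by rw [h3, one_mul]
      _ = (b : ZMod M) ^ t * ((b : ZMod M) * (Int.gcdA b M : ZMod M)) ^ (k + 1) := by
          rw [pow_add, mul_pow, mul_assoc]
      _ = _ := by rw [hinv, one_pow, mul_one]

end Index

/-! ### Assembly for n = gkdN, A = gkα, f = gdf'. -/

section Main

/-- The structure theorem in terms of the factorization `n = g k d N`, where `(n, A) = g k`,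
`(n, f) = g d` and `(n, A, f) = g`. -/
theorem groupM_structure {r s rhat f' α αbar : ℤ} {g k d N M : ℕ}
    (hg0 : 0 < g) (hk0 : 0 < k) (hd0 : 0 < d) (hN : 0 < N) (hM : 0 < M)
    (hrs : IsCoprime r s) (hk : (k * N : ℤ) ∣ r - s)
    (hμ : k * N * M = (r ^ (d * N) - s ^ (d * N)).natAbs)
    (hrhat : r * rhat ≡ 1 [ZMOD (k * N * M : ℕ)])
    (hf' : IsCoprime f' (k * N : ℤ)) (hkd : IsCoprime (k : ℤ) d)
    (hαbar : α * αbar ≡ 1 [ZMOD (d * N : ℕ)])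
    {R : ℤ} (hR : R = powMod M (s * rhat) (d * (f' * αbar))) :
    R ^ N ≡ 1 [ZMOD M] ∧ Nat.card (BeylGroup M N R 1) = M * N ∧
    Nonempty (GroupM r (g * k * d * N) s (g * d * f') (g * k * α) ≃*
      Monoid.Coprod (Monoid.CoprodI fun _ : Fin g => BeylGroup M N R 1)
        (FreeGroup (Fin (g * k - g)))) := by
  have hα : IsCoprime α ((d * N : ℕ) : ℤ) := by
    obtain ⟨w, hw⟩ := hαbar.dvd
    exact ⟨αbar, w, by linear_combination -hw⟩
  have hαbar' : IsCoprime αbar ((d * N : ℕ) : ℤ) := by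
    obtain ⟨w, hw⟩ := hαbar.dvd
    exact ⟨α, w, by linear_combination -hw⟩
  have hdvdN : (N : ℤ) ∣ ((d * N : ℕ) : ℤ) := Int.natCast_dvd_natCast.mpr (Dvd.intro_left _ rfl)
  have hdvdd : (d : ℤ) ∣ ((d * N : ℕ) : ℤ) := Int.natCast_dvd_natCast.mpr (Dvd.intro _ rfl)
  -- A natural j suffices: s r̂ has order dividing dN modulo M, so d f' ᾱ matters only modulo dN.
  obtain ⟨j, hjf⟩ : ∃ j : ℕ, (j : ℤ) ≡ f' * αbar [ZMOD N] :=
    ⟨(f' * αbar % N).toNat, by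
      rw [Int.toNat_of_nonneg (Int.emod_nonneg _ (by positivity))]
      exact Int.mod_modEq _ _⟩
  have hj : Nat.Coprime j N := by
    rw [← Nat.isCoprime_iff_coprime]
    have h1 : IsCoprime (f' * αbar) (N : ℤ) :=
      IsCoprime.mul_left (hf'.of_isCoprime_of_dvd_right (Dvd.intro_left _ rfl))
        (hαbar'.of_isCoprime_of_dvd_right hdvdN)
    obtain ⟨w, hw⟩ := hjf.dvd
    have h2 : (j : ℤ) = f' * αbar + N * (-w) := by linear_combination -hw
    rw [h2]
    exact IsCoprime.add_mul_left_left h1 _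
  have hjα : j * α ≡ f' [ZMOD N] := by
    have h1 := hjf.mul_right α
    have h2 := (hαbar.of_dvd hdvdN).mul_left f'
    rw [mul_one] at h2
    refine h1.trans (Int.ModEq.trans ?_ h2)
    exact congrArg (fun q : ℤ => q % N) (by ring)
  have hSpow : ((s * rhat : ℤ) : ZMod (k * N * M)) ^ (d * N) = 1 := by
    have h1 := (ZMod.intCast_eq_intCast_iff _ _ _).mpr hrhat
    have h2 : ((r ^ (d * N) - s ^ (d * N) : ℤ) : ZMod (k * N * M)) = 0 := by
      rw [ZMod.intCast_zmod_eq_zero_iff_dvd, hμ, Int.natAbs_dvd]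
    push_cast at h1 h2 ⊢
    rw [mul_pow, ← sub_eq_zero.mp h2, ← mul_pow, h1, one_pow]
  have hdN : d * N ≠ 0 := by positivity
  have : NeZero (d * N) := ⟨hdN⟩
  let S : (ZMod (k * N * M))ˣ := Units.ofPowEqOne _ _ hSpow hdN
  have hS : S ^ (d * N) = 1 := Units.pow_ofPowEqOne hSpow hdN
  have hST : (S : ZMod (k * N * M)) = ((s * rhat : ℤ) : ZMod (k * N * M)) := rfl
  have hSM : (s * rhat) ^ (d * N) ≡ 1 [ZMOD M] := by
    have h1 : (s * rhat) ^ (d * N) ≡ 1 [ZMOD (k * N * M : ℕ)] := by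
      rw [← ZMod.intCast_eq_intCast_iff, Int.cast_pow, hSpow, Int.cast_one]
    exact h1.of_dvd (Int.natCast_dvd_natCast.mpr (Dvd.intro_left _ rfl))
  have hR' : R ≡ (s * rhat) ^ (d * j) [ZMOD M] := by
    rw [hR]
    refine powMod_modEq (by positivity : 0 < d * N) hSM ?_
    push_cast
    exact hjf.mul_left'
  have hRN : R ^ N ≡ 1 [ZMOD M] := by
    have h1 := hR'.pow N
    have h2 := hSM.pow j
    rw [one_pow, ← pow_mul] at h2
    rw [← pow_mul, mul_right_comm] at h1
    exact h1.trans h2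
  set n := g * k * d * N with hn
  have hn0 : 0 < n := by positivity
  have hf : (g * d * f' : ℤ) * (r - s) ≡ 0 [ZMOD n] := by
    rw [Int.modEq_zero_iff_dvd]
    obtain ⟨w, hw⟩ := hk
    exact ⟨f' * w, by rw [hn, hw]; push_cast; ring⟩
  have hAp : ∀ x : ℤ, (n : ℤ) ∣ x * (g * k * α) ↔ ((d * N : ℕ) : ℤ) ∣ x := by
    intro x
    rw [show x * (g * k * α) = (g * k : ℤ) * (x * α) by ring,
      show (n : ℤ) = (g * k : ℤ) * ((d * N : ℕ) : ℤ) by rw [hn]; push_cast; ring,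
      mul_dvd_mul_iff_left (by positivity)]
    exact ⟨fun h => hα.symm.dvd_of_dvd_mul_right h, fun h => h.mul_right _⟩
  set yz : Multiplicative (ZMod n) := Multiplicative.ofAdd ((g * d * f' : ℤ) : ZMod n) with hyz
  set vz : Multiplicative (ZMod n) := Multiplicative.ofAdd ((-(g * k * α) : ℤ) : ZMod n) with hvz
  have hyzpow : ∀ z : ℤ, yz ^ z = Multiplicative.ofAdd ((z * (g * d * f') : ℤ) : ZMod n) := by
    intro z
    rw [hyz, ← ofAdd_zsmul, zsmul_eq_mul, ← Int.cast_mul]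
  have hvzpow : ∀ z : ℤ, vz ^ z = Multiplicative.ofAdd ((z * -(g * k * α) : ℤ) : ZMod n) := by
    intro z
    rw [hvz, ← ofAdd_zsmul, zsmul_eq_mul, ← Int.cast_mul]
  have hvp : vz ^ (d * N) = 1 := by
    rw [← zpow_natCast, hvzpow, ← ofAdd_zero, Multiplicative.ofAdd.injective.eq_iff,
      ZMod.intCast_zmod_eq_zero_iff_dvd, mul_neg, dvd_neg, hAp]
  have hrel : vz * yz ^ r * vz⁻¹ = yz ^ s := by
    rw [mul_comm vz, mul_inv_cancel_right, hyzpow, hyzpow]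
    congr 1
    rw [ZMod.intCast_eq_intCast_iff, Int.modEq_comm, Int.modEq_iff_dvd]
    have := Int.modEq_zero_iff_dvd.mp hf
    exact (by ring : (g * d * f' : ℤ) * (r - s) = r * (g * d * f') - s * (g * d * f')) ▸ this
  have hyμ : yz ^ (k * N * M) = 1 := hμ ▸ pow_natAbs_sub_eq_one hvp hrel
  obtain ⟨ν, hνy, hνv⟩ := SplitMetacyclic.exists_hom (k * N * M) (d * N) S hS hST yz vz hyμ hvp
    (conj_eq_zpow hyμ hrhat hrel)
  have hcardD : Nat.card (Multiplicative (ZMod n) ⧸ ν.range) = g := by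
    refine card_quotient_eq ⟨k * d * N, by rw [hn]; ring⟩ _ fun x => ?_
    constructor
    · rintro ⟨h, hh⟩
      obtain ⟨z, t, rfl⟩ := SplitMetacyclic.exists_eq_zpow_mul_zpow _ _ S hS h
      rw [map_mul, map_zpow, map_zpow, hνy, hνv, hyzpow, hvzpow, ← ofAdd_add,
        Multiplicative.ofAdd.injective.eq_iff, ← Int.cast_add, ZMod.intCast_eq_intCast_iff] at hh
      obtain ⟨w, hw⟩ := hh.dvd
      exact ⟨k * d * N * w + z * (d * f') - t * (k * α), by
        rw [hn] at hw
        push_cast at hw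
        linear_combination hw⟩
    · rintro ⟨x', rfl⟩
      -- df' and kα generate ℤ modulo kdN; the coefficients combine the three Bézout identities.
      obtain ⟨a, b, hab⟩ : ∃ a b : ℤ, (k * d * N : ℤ) ∣ a * (d * f') - b * (k * α) - x' := by
        obtain ⟨p₁, q₁, h₁⟩ := hf'
        obtain ⟨p₂, q₂, h₂⟩ := hα
        obtain ⟨p₃, q₃, h₃⟩ := hkd
        push_cast at h₂
        exact ⟨q₃ * p₁ * x', -(p₃ * p₂ * x'), -(x' * (p₃ * q₂ + q₃ * q₁)), by
          linear_combination (q₃ * d * x') * h₁ + (p₃ * k * x') * h₂ + x' * h₃⟩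
      refine ⟨SplitMetacyclic.genY _ _ S hS ^ a * SplitMetacyclic.genV _ _ S hS ^ b, ?_⟩
      rw [map_mul, map_zpow, map_zpow, hνy, hνv, hyzpow, hvzpow, ← ofAdd_add,
        Multiplicative.ofAdd.injective.eq_iff, ← Int.cast_add, ZMod.intCast_eq_intCast_iff,
        Int.modEq_comm, Int.modEq_iff_dvd]
      obtain ⟨w, hw⟩ := hab
      exact ⟨w, by rw [hn]; push_cast; linear_combination (g : ℤ) * hw⟩
  have hcardU : Nat.card (Multiplicative (ZMod n) ⧸
      (Subgroup.zpowers (SplitMetacyclic.genV _ _ S hS)).map ν) = g * k := by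
    refine card_quotient_eq ⟨d * N, by rw [hn]; ring⟩ _ fun x => ?_
    rw [MonoidHom.map_zpowers, hνv, Subgroup.mem_zpowers_iff]
    simp only [hvzpow, Multiplicative.ofAdd.injective.eq_iff, ZMod.intCast_eq_intCast_iff]
    constructor
    · rintro ⟨t, ht⟩
      obtain ⟨w, hw⟩ := ht.dvd
      exact ⟨d * N * w - t * α, by
        rw [hn] at hw
        push_cast at hw ⊢
        linear_combination hw⟩
    · rintro ⟨x', rfl⟩
      obtain ⟨a, b, hab⟩ := hα
      refine ⟨-a * x', Int.modEq_iff_dvd.mpr ⟨b * x', ?_⟩⟩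
      rw [hn]
      push_cast at hab ⊢
      linear_combination (-(g * k * x' : ℤ)) * hab
  have hcard : g * Nat.card ν.range = n := by
    have h1 := Subgroup.card_eq_card_quotient_mul_card_subgroup ν.range
    rw [hcardD] at h1
    rw [← h1]
    exact Nat.card_zmod n
  obtain ⟨⟨e₁⟩, hB⟩ := nonempty_beylGroup_mulEquiv_ker hg0 hk0 hd0 hN hM hrs hk hμ hrhat hf'
    (hα.of_isCoprime_of_dvd_right hdvdd) hkd hj hjα S hS hST ν hνy hνv hcard hR'
  obtain ⟨e₂⟩ := groupM_mulEquiv_splitGroup r n s _ _ hn0 hf _ _ hμ rhat hrhat hAp S hS hST ν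
    hνy hνv
  have : NeZero n := ⟨hn0.ne'⟩
  have : Finite (Multiplicative (ZMod n)) := inferInstanceAs (Finite (ZMod n))
  refine ⟨hRN, hB, ⟨e₂.trans (MulEquiv.coprodCongr (coprodICongr ?_ e₁.symm)
    (FreeGroup.freeGroupCongr ?_))⟩⟩
  · exact Finite.equivFinOfCardEq hcardD
  · have : Finite (FreeIndex ν (Subgroup.zpowers (SplitMetacyclic.genV _ _ S hS))) :=
      inferInstanceAs (Finite (Subtype _))
    exact Finite.equivFinOfCardEq (by rw [card_freeIndex, hcardU, hcardD])

end Main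

/-! ### The gcd factorization of n and the theorem. -/

/-- The greatest common divisors `(n, A) = g k`, `(n, f) = g d`, `(n, A, f) = g` give a
factorization `n = g k d N` with `k` and `d` coprime. -/
theorem exists_factorization {n : ℕ} (hn : 0 < n) (A f : ℤ) :
    ∃ g k d N : ℕ, 0 < g ∧ 0 < k ∧ 0 < d ∧ 0 < N ∧ n = g * k * d * N ∧ Int.gcd n A = g * k ∧
      Int.gcd n f = g * d ∧ Int.gcd (Int.gcd n A) f = g ∧ Nat.Coprime k d := by
  have e1 : Int.gcd n A = Nat.gcd n A.natAbs := rfl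
  have e2 : Int.gcd n f = Nat.gcd n f.natAbs := rfl
  have e3 : Int.gcd (Int.gcd n A) f = Nat.gcd (Int.gcd n A) (Int.gcd n f) := by
    have : Int.gcd (Int.gcd n A) f = Nat.gcd (Nat.gcd n A.natAbs) f.natAbs := rfl
    rw [this, e1, e2, ← Nat.gcd_assoc, Nat.gcd_eq_left (Nat.gcd_dvd_left n A.natAbs)]
  have hA : Int.gcd n A ∣ n := e1 ▸ Nat.gcd_dvd_left _ _
  have hf : Int.gcd n f ∣ n := e2 ▸ Nat.gcd_dvd_left _ _
  rw [e3]
  generalize Int.gcd n A = a at *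
  generalize Int.gcd n f = b at *
  have ha0 : 0 < a := Nat.pos_of_dvd_of_pos hA hn
  obtain ⟨k, d, hkd, hk, hd⟩ := Nat.exists_coprime a b
  set g := Nat.gcd a b with hg
  have hg0 : 0 < g := Nat.gcd_pos_of_pos_left _ ha0
  obtain ⟨n', hn'⟩ : g ∣ n := (Nat.gcd_dvd_left a b).trans hA
  have hk' : k ∣ n' := by
    rw [hk, hn', mul_comm k] at hA
    exact Nat.dvd_of_mul_dvd_mul_left hg0 hA
  have hd' : d ∣ n' := by
    rw [hd, hn', mul_comm d] at hf
    exact Nat.dvd_of_mul_dvd_mul_left hg0 hf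
  obtain ⟨N, hN⟩ := hkd.mul_dvd_of_dvd_of_dvd hk' hd'
  have hnn : n = g * k * d * N := by rw [hn', hN]; ring
  have hpos : 0 < g * k * d * N := hnn ▸ hn
  exact ⟨g, k, d, N, hg0, Nat.pos_of_ne_zero (by rintro rfl; simp at hpos),
    Nat.pos_of_ne_zero (by rintro rfl; simp at hpos),
    Nat.pos_of_ne_zero (by rintro rfl; simp at hpos), hnn, by rw [hk]; ring, by rw [hd]; ring,
    rfl, hkd⟩

theorem theoremC
    (r : ℤ) (n : ℕ) (s f A : ℤ) (hn : 0 < n)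
    (hf : f * (r - s) ≡ 0 [ZMOD n])
    (hrs : Int.gcd r s = 1)
    -- `dA = (n, A)`, `df = (n, f)`, `dAf = (n, A, f)`
    (dA df dAf : ℕ) (hdA : dA = Int.gcd n A) (hdf : df = Int.gcd n f)
    (hdAf : dAf = Int.gcd dA f)
    (μ : ℕ) (hμ : μ = (r ^ (n / dA) - s ^ (n / dA)).natAbs) (hμ0 : μ ≠ 0)
    (rhat : ℤ) (hrhat : r * rhat ≡ 1 [ZMOD μ])
    (α αbar : ℤ) (hα : α = A / (dA : ℤ)) (hαbar : α * αbar ≡ 1 [ZMOD (n / dA : ℕ)])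
    -- the parameters of `Gbar = B(M, N, R, 1)`
    (M N : ℕ) (hM : M = df * μ / n) (hN : N = n * dAf / (dA * df))
    (R : ℤ) (hR : R = powMod M (s * rhat) (f * αbar / (dAf : ℤ))) :
    -- `M` and `N` are integers, and `B(M, N, R, 1)` is a finite metacyclic group
    (n ∣ df * μ ∧ dA * df ∣ n * dAf ∧ R ^ N ≡ 1 [ZMOD M] ∧
      Finite (BeylGroup M N R 1) ∧ IsMetacyclic (BeylGroup M N R 1)) ∧
    Nonempty (GroupM r n s f A ≃*
      Monoid.Coprod (Monoid.CoprodI fun _ : Fin dAf => BeylGroup M N R 1)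
        (FreeGroup (Fin (dA - dAf)))) ∧
    (dA * df = n * dAf →
      Nonempty (GroupM r n s f A ≃*
        Monoid.Coprod (Monoid.CoprodI fun _ : Fin dAf => Multiplicative (ZMod M))
          (FreeGroup (Fin (dA - dAf))))) := by
  obtain ⟨g, k, d, N', hg0, hk0, hd0, hN0, hnn, hgA, hgf, hgAf, hkd⟩ := exists_factorization hn A f
  have hA' : (dA : ℤ) ∣ A := hdA ▸ Int.gcd_dvd_right ..
  have hf'' : (df : ℤ) ∣ f := hdf ▸ Int.gcd_dvd_right ..
  have hcop : Int.gcd n f = df := hdf.symm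
  rw [hdA, hgAf] at hdAf
  rw [hgA] at hdA
  rw [hgf] at hdf
  subst hdA hdf dAf
  have hNN : N = N' := by
    rw [hN, hnn, show g * k * d * N' * g = g * k * (g * d) * N' by ring]
    exact Nat.mul_div_cancel_left _ (by positivity)
  subst hNN
  have hp : n / (g * k) = d * N := by
    rw [hnn, show g * k * d * N = g * k * (d * N) by ring]
    exact Nat.mul_div_cancel_left _ (by positivity)
  rw [hp] at hμ hαbar
  obtain ⟨f', rfl⟩ := hf''
  obtain ⟨α', rfl⟩ := hA'
  have hαα : α = α' := by
    rw [hα]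
    exact Int.mul_ediv_cancel_left _ (by positivity)
  subst hαα
  have hi : ((g * d : ℕ) : ℤ) * f' * αbar / g = d * (f' * αbar) := by
    rw [show ((g * d : ℕ) : ℤ) * f' * αbar = g * (d * (f' * αbar)) by push_cast; ring]
    exact Int.mul_ediv_cancel_left _ (by positivity)
  rw [hi] at hR
  have hf' : IsCoprime f' (k * N : ℤ) := by
    rw [hnn, show ((g * k * d * N : ℕ) : ℤ) = ((g * d : ℕ) : ℤ) * (k * N) by push_cast; ring,
      Int.gcd_mul_left, Int.natAbs_natCast] at hcop
    rw [Int.isCoprime_iff_gcd_eq_one, Int.gcd_comm]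
    exact Nat.eq_of_mul_eq_mul_left (by positivity : 0 < g * d) (by rw [hcop, mul_one])
  have hk : (k * N : ℤ) ∣ r - s := by
    rw [Int.modEq_zero_iff_dvd, hnn, mul_assoc (_ : ℤ) f',
      show ((g * k * d * N : ℕ) : ℤ) = ((g * d : ℕ) : ℤ) * (k * N) by push_cast; ring,
      mul_dvd_mul_iff_left (by positivity)] at hf
    exact hf'.symm.dvd_of_dvd_mul_left hf
  obtain ⟨M', hM'⟩ : k * N ∣ μ := by
    rw [hμ, ← Int.natCast_dvd]
    push_cast
    exact hk.trans (sub_dvd_pow_sub_pow _ _ _)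
  have hdfμ : g * d * μ = n * M' := by rw [hM', hnn]; ring
  have hMM : M = M' := by
    rw [hM, hdfμ]
    exact Nat.mul_div_cancel_left _ hn
  subst hMM
  have hM0 : 0 < M := Nat.pos_of_ne_zero fun h => hμ0 (by rw [hM', h, mul_zero])
  subst hM'
  subst hnn
  obtain ⟨hRN, hcard, ⟨e⟩⟩ := groupM_structure (g := g) hg0 hk0 hd0 hN0 hM0
    (Int.isCoprime_iff_gcd_eq_one.mpr hrs) hk hμ hrhat hf' (Nat.isCoprime_iff_coprime.mpr hkd)
    hαbar hR
  have e' : GroupM r (g * k * d * N) s ((g * d : ℕ) * f') ((g * k : ℕ) * α) ≃*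
      Monoid.Coprod (Monoid.CoprodI fun _ : Fin g => BeylGroup M N R 1)
        (FreeGroup (Fin (g * k - g))) := by
    rw [Nat.cast_mul, Nat.cast_mul]
    exact e
  refine ⟨⟨⟨M, hdfμ⟩, ⟨N, by ring⟩, hRN, finite_beylGroup hM0 hN0, isMetacyclic_beylGroup hM0⟩,
    ⟨e'⟩, fun h => ?_⟩
  -- The extra hypothesis reads gk·gd = gkdN·g. Then ⟨a⟩ is the whole group, which is cyclic of
  -- order M.
  have hN1 : N = 1 := by
    have h1 : g * k * (g * d) * N = g * k * (g * d) * 1 := by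
      rw [mul_one]
      linear_combination -h
    exact Nat.eq_of_mul_eq_mul_left (by positivity) h1
  have hcyc : IsCyclic (BeylGroup M N R 1) := by
    rw [hN1]
    exact isCyclic_beylGroup_one hM0
  have e₂ : Multiplicative (ZMod M) ≃* BeylGroup M N R 1 := by
    have e₃ := zmodCyclicMulEquiv hcyc
    rwa [hcard, hN1, mul_one, ← hN1] at e₃
  exact ⟨e'.trans (MulEquiv.coprodCongr (coprodICongr (Equiv.refl _) e₂.symm) (MulEquiv.refl _))⟩
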